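/- A *strong proximity lattice* $(S,\prec)$ is a bounded distributive lattice $S$ with an idempotent relation $\prec$ on $S$ such that $\{a\mid a\prec b\}$ is an ideal and $\{b\mid a\prec b\}$ is a filter, and such that $a\prec 0$ implies $a=0$; $1\prec a$ implies $a=1$; $a\prec b\vee c$ implies $a\le b'\vee c'$ for some $b'\prec b$, $c'\prec c$; and $b\wedge c\prec a$ implies $b'\wedge c'\le a$ for some $b'\succ b$, $c'\succ c$. Its dual $S^{d}$ is the opposite lattice with the relation $\succ$. It represents the stably compact locale $\mathrm{Spec}(S)$ whose frame consists of the rounded ideals of $S$. A *strong continuous entailment relation* $(G,\vdash,\prec)$ is an entailment relation $\vdash$ between finite subsets of a set $G$ (reflexive, monotone, closed under cut) with an idempotent relation $\prec$ on $G$ such that for all finite $A,B\subseteq G$ we have $\exists A'\,(A\prec_U A'\vdash B)\iff\exists B'\,(A\vdash B'\prec_L B)$. Here $A\prec_U A'$ means that each $a'\in A'$ has some $a\in A$ with $a\prec a'$, and $B'\prec_L B$ means that each $b'\in B'$ has some $b\in B$ with $b'\prec b$. Its dual $(G,\vdash,\prec)^{d}$ reverses both $\vdash$ and $\prec$. Put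 $\ll\,=\{(A,B)\mid\exists A'\,(A\prec_U A'\vdash B)\}$. For a finite set $\mathcal V$ of finite sets let $\mathcal V^{*}$ be the set of all unions $\bigcup_{A\in\mathcal V}C_A$ with $\emptyset\ne C_A\subseteq A$. For relations $r,s$ between finite sets, the cut composition is: $A\,(s\cdot r)\,C$ iff there is a finite $\mathcal V$ with $A\,r\,B'$ for all $B'\in\mathcal V^{*}$ and $B\,s\,C$ for all $B\in\mathcal V$. The symbol $\cong$ between strong continuous entailment relations denotes an isomorphism in the following category. The morphisms $(G,\vdash,\prec)\to(G',\vdash',\prec')$ are the relations $r$ between finite subsets of $G$ and of $G'$ such that * $A\,r\,B$ implies $(A\cup A')\,r\,(B\cup B')$; * $\ll'\cdot\, r=r=r\,\cdot\ll$; * if $A\,r\,B$, then there is a finite set $\mathcal U$ of finite subsets of $G$ such that $A\vdash C$ for all $C\in\mathcal U^{*}$, and each $A'\in\mathcal U$ satisfies $A'\,r\,\{b\}$ for some $b\in B$. Composition is cut composition, and the identities are the relations $\ll$. For a strong proximity lattice $S$ let $S_{\mathfrak V}=\{\langle p,a\rangle\mid p\in\mathbb Q,\ a\in S\}$ and define four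 strong continuous entailment relations on $S_{\mathfrak V}$: * $\mathfrak V(S)$ (valuations): $\langle p,a\rangle\prec\langle q,b\rangle$ iff $q<p$ and $a\prec b$; $\vdash$ is generated by $\vdash\langle p,a\rangle$ ($p<0$); $\langle p,0\rangle\vdash$ ($0<p$); $\langle p,a\rangle\vdash\langle q,b\rangle$ ($q\le p$, $a\le b$); and the modular axioms, for $p+q=r+s$: $\langle p,a\rangle,\langle q,b\rangle\vdash\langle r,a\wedge b\rangle,\langle s,a\vee b\rangle$ and $\langle r,a\wedge b\rangle,\langle s,a\vee b\rangle\vdash\langle p,a\rangle,\langle q,b\rangle$. * $\mathfrak C(S)$ (covaluations): $\langle p,a\rangle\prec\langle q,b\rangle$ iff $p<q$ and $a\prec b$; $\vdash$ is generated by $\langle p,a\rangle\vdash$ ($p<0$); $\vdash\langle p,1\rangle$ ($0<p$); $\langle p,a\rangle\vdash\langle q,b\rangle$ ($p\le q$, $a\le b$); and the same modular axioms. * $\mathfrak V_P(S)$ (probabilistic valuations): as $\mathfrak V(S)$, with the extra axioms $\langle p,a\rangle\vdash$ ($1<p$) and $\vdash\langle p,1\rangle$ ($p<1$). * $\mathfrak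 C_P(S)$ (probabilistic covaluations): as $\mathfrak C(S)$, with the extra axioms $\vdash\langle p,a\rangle$ ($1<p$) and $\langle p,0\rangle\vdash$ ($p<1$). Let $\mathfrak V(\mathrm{Spec}\,S)$, the space of valuations on $\mathrm{Spec}(S)$, be the locale presented by the geometric theory over $S_{\mathfrak V}$ with axioms $$\top\vdash\langle p,a\rangle\ (p<0),\qquad \langle p,0\rangle\vdash\bot\ (0<p),\qquad \langle p,a\rangle\vdash\langle q,b\rangle\ (q\le p,\ a\le b),$$ $$\langle p,a\rangle\wedge\langle q,b\rangle\vdash\bigvee_{p'+q'=p+q}\langle p',a\wedge b\rangle\wedge\langle q',a\vee b\rangle,\qquad \langle p,a\wedge b\rangle\wedge\langle q,a\vee b\rangle\vdash\bigvee_{p'+q'=p+q}\langle p',a\rangle\wedge\langle q',b\rangle,$$ $$\langle p,a\rangle\vdash\langle q,b\rangle\ (q<p,\ a\prec b),\qquad \langle p,a\rangle\vdash\bigvee_{q>p,\ b\prec a}\langle q,b\rangle .$$ Let $\mathfrak C(\mathrm{Spec}\,S)$, the space of covaluations, be presented by the theory with the same two modular axioms and $$\langle p,a\rangle\vdash\bot\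 (p<0),\qquad \top\vdash\langle p,1\rangle\ (0<p),\qquad \langle p,a\rangle\vdash\langle q,b\rangle\ (p\le q,\ a\le b),$$ $$\langle p,a\rangle\vdash\langle q,b\rangle\ (p<q,\ a\prec b),\qquad \langle p,a\rangle\vdash\bigvee_{q<p,\ b\prec a}\langle q,b\rangle .$$ The spaces $\mathfrak V_P(\mathrm{Spec}\,S)$ and $\mathfrak C_P(\mathrm{Spec}\,S)$ of probabilistic valuations and covaluations are presented by adding, respectively, $\langle p,a\rangle\vdash\bot$ ($1<p$), $\top\vdash\langle p,1\rangle$ ($p<1$), and $\top\vdash\langle p,a\rangle$ ($1<p$), $\langle p,0\rangle\vdash\bot$ ($p<1$). The de Groot dual $X^{d}$ of a locale $X$ among these is the locale whose frame is the set of Scott open filters of the frame of $X$, ordered by inclusion. **Theorem.** For every strong proximity lattice $S$: 1. $\mathfrak V(S)^{d}\cong\mathfrak C(S^{d})$ and $\mathfrak C(S)^{d}\cong\mathfrak V(S^{d})$; 2. $\mathfrak V_P(S)^{d}\cong\mathfrak C_P(S^{d})$ and $\mathfrak C_P(S)^{d}\cong\mathfrak V_P(S^{d})$; 3. correspondingly,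 the de Groot duals of the spaces are, up to isomorphism of locales, $\mathfrak V(\mathrm{Spec}\,S)^{d}\cong\mathfrak C(\mathrm{Spec}\,S^{d})$ and $\mathfrak C(\mathrm{Spec}\,S)^{d}\cong\mathfrak V(\mathrm{Spec}\,S^{d})$; 4. and likewise $\mathfrak V_P(\mathrm{Spec}\,S)^{d}\cong\mathfrak C_P(\mathrm{Spec}\,S^{d})$ and $\mathfrak C_P(\mathrm{Spec}\,S)^{d}\cong\mathfrak V_P(\mathrm{Spec}\,S^{d})$. -/

import Mathlib

universe u v w

namespace DeGroot

open scoped Classical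

/-! ### Strong proximity lattices -/

/-- A proximity relation between (bounded) distributive lattices: `{a | r a b}` is an ideal for
every `b`, and `{b | r a b}` is a filter for every `a`. -/
structure IsProximityRelation {S : Type u} {S' : Type v} [DistribLattice S] [BoundedOrder S]
    [DistribLattice S'] [BoundedOrder S'] (r : S → S' → Prop) : Prop where
  bot_left : ∀ b, r ⊥ b
  sup_left : ∀ {a a' b}, r a b → r a' b → r (a ⊔ a') b
  lower_left : ∀ {a a' b}, a' ≤ a → r a b → r a' b
  top_right : ∀ a, r a ⊤
  inf_right : ∀ {a b b'}, r a b → r a b' → r a (b ⊓ b')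
  upper_right : ∀ {a b b'}, b ≤ b' → r a b → r a b'

/-- A strong proximity lattice: a bounded distributive lattice with an idempotent proximity
relation whose approximations of `⊥`, `⊤` and of binary joins and meets are strong. -/
class StrongProximityLattice (S : Type u) extends DistribLattice S, BoundedOrder S where
  /-- the relation `≺` -/
  prec : S → S → Prop
  isProximity : IsProximityRelation prec
  idem : ∀ a b, (∃ c, prec a c ∧ prec c b) ↔ prec a b
  prox_zero : ∀ a, prec a ⊥ → a = ⊥
  prox_sup : ∀ a b c, prec a (b ⊔ c) → ∃ b' c', a ≤ b' ⊔ c' ∧ prec b' b ∧ prec c' c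
  prox_one : ∀ a, prec ⊤ a → a = ⊤
  prox_inf : ∀ a b c, prec (b ⊓ c) a → ∃ b' c', prec b b' ∧ prec c c' ∧ b' ⊓ c' ≤ a

open StrongProximityLattice (prec)

/-- The dual of a strong proximity lattice: the opposite lattice with the opposite relation `≻`. -/
instance dualLattice (S : Type u) [h : StrongProximityLattice S] :
    StrongProximityLattice Sᵒᵈ where
  prec a b := prec (OrderDual.ofDual b) (OrderDual.ofDual a)
  isProximity :=
    { bot_left := fun b => h.isProximity.top_right (OrderDual.ofDual b)
      sup_left := fun h₁ h₂ => h.isProximity.inf_right h₁ h₂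
      lower_left := fun h₁ h₂ => h.isProximity.upper_right h₁ h₂
      top_right := fun a => h.isProximity.bot_left (OrderDual.ofDual a)
      inf_right := fun h₁ h₂ => h.isProximity.sup_left h₁ h₂
      upper_right := fun h₁ h₂ => h.isProximity.lower_left h₁ h₂ }
  idem a b := by
    rw [← h.idem (OrderDual.ofDual b) (OrderDual.ofDual a)]
    exact ⟨fun ⟨c, h₁, h₂⟩ => ⟨OrderDual.ofDual c, h₂, h₁⟩,
      fun ⟨c, h₁, h₂⟩ => ⟨OrderDual.toDual c, h₂, h₁⟩⟩
  prox_zero a ha := h.prox_one (OrderDual.ofDual a) ha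
  prox_sup a b c habc := by
    obtain ⟨b', c', h₁, h₂, h₃⟩ := h.prox_inf (OrderDual.ofDual a) (OrderDual.ofDual b)
      (OrderDual.ofDual c) habc
    exact ⟨OrderDual.toDual b', OrderDual.toDual c', h₃, h₁, h₂⟩
  prox_one a ha := h.prox_zero (OrderDual.ofDual a) ha
  prox_inf a b c habc := by
    obtain ⟨b', c', h₁, h₂, h₃⟩ := h.prox_sup (OrderDual.ofDual a) (OrderDual.ofDual b)
      (OrderDual.ofDual c) habc
    exact ⟨OrderDual.toDual b', OrderDual.toDual c', h₂, h₃, h₁⟩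

/-! ### Strong continuous entailment relations -/

/-- An entailment relation on `G`: reflexive, monotone and closed under cut. -/
structure IsEntailment {G : Type u} (E : Finset G → Finset G → Prop) : Prop where
  refl : ∀ a, E {a} {a}
  mono : ∀ {A B} (A' B' : Finset G), E A B → E (A' ∪ A) (B ∪ B')
  cut : ∀ {A B} (a : G), E A (B ∪ {a}) → E ({a} ∪ A) B → E A B

/-- The entailment relation generated by a set of axioms, i.e. the smallest entailment relation
that contains them. -/
inductive Generated {G : Type u} (ax : Finset G → Finset G → Prop) :
    Finset G → Finset G → Prop
  | ax {A B : Finset G} : ax A B → Generated ax A B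
  | refl (a : G) : Generated ax {a} {a}
  | mono {A B : Finset G} (A' B' : Finset G) : Generated ax A B →
      Generated ax (A' ∪ A) (B ∪ B')
  | cut {A B : Finset G} (a : G) : Generated ax A (B ∪ {a}) → Generated ax ({a} ∪ A) B →
      Generated ax A B

theorem Generated.isEntailment {G : Type u} (ax : Finset G → Finset G → Prop) :
    IsEntailment (Generated ax) :=
  ⟨Generated.refl, fun A' B' h => Generated.mono A' B' h, fun a h h' => Generated.cut a h h'⟩

theorem Generated.minimal {G : Type u} {ax E : Finset G → Finset G → Prop}
    (hE : IsEntailment E) (hax : ∀ A B, ax A B → E A B) {A B : Finset G}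
    (h : Generated ax A B) : E A B := by
  induction h with
  | ax h => exact hax _ _ h
  | refl a => exact hE.refl a
  | mono A' B' _ ih => exact hE.mono A' B' ih
  | cut a _ _ ih₁ ih₂ => exact hE.cut a ih₁ ih₂

/-- `A ≺_L B`: every element of `A` is `≺` some element of `B`. -/
def LowerExt {G : Type u} (p : G → G → Prop) (A B : Finset G) : Prop :=
  ∀ a ∈ A, ∃ b ∈ B, p a b

/-- `A ≺_U B`: every element of `B` is `≻` some element of `A`. -/
def UpperExt {G : Type u} (p : G → G → Prop) (A B : Finset G) : Prop :=
  ∀ b ∈ B, ∃ a ∈ A, p a b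

/-- A strong continuous entailment relation on the set `G`. -/
structure StrongContEnt (G : Type u) where
  /-- the entailment relation `⊢` -/
  ent : Finset G → Finset G → Prop
  /-- the idempotent relation `≺` -/
  lt : G → G → Prop
  isEntailment : IsEntailment ent
  idem : ∀ a b, (∃ c, lt a c ∧ lt c b) ↔ lt a b
  interpolation : ∀ A B, (∃ A', UpperExt lt A A' ∧ ent A' B) ↔ ∃ B', ent A B' ∧ LowerExt lt B' B

/-- The dual of a strong continuous entailment relation: both relations are reversed. -/
def StrongContEnt.dual {G : Type u} (E : StrongContEnt G) : StrongContEnt G where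
  ent A B := E.ent B A
  lt a b := E.lt b a
  isEntailment :=
    { refl := E.isEntailment.refl
      mono := fun A' B' h => by
        have := E.isEntailment.mono B' A' h
        rwa [Finset.union_comm B' _, Finset.union_comm _ A'] at this
      cut := fun a h h' => by
        rw [Finset.union_comm] at h h'
        exact E.isEntailment.cut a h' h }
  idem a b := by
    rw [← E.idem b a]
    exact ⟨fun ⟨c, h₁, h₂⟩ => ⟨c, h₂, h₁⟩, fun ⟨c, h₁, h₂⟩ => ⟨c, h₂, h₁⟩⟩
  interpolation A B := by
    have := E.interpolation B A
    exact ⟨fun ⟨A', h₁, h₂⟩ => (this.2 ⟨A', h₂, h₁⟩).imp fun _ h => ⟨h.2, h.1⟩,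
      fun ⟨B', h₁, h₂⟩ => (this.1 ⟨B', h₂, h₁⟩).imp fun _ h => ⟨h.2, h.1⟩⟩

/-- The idempotent Karoubi endomorphism `≪_⊢` of a strong continuous entailment relation. -/
def StrongContEnt.ll {G : Type u} (E : StrongContEnt G) (A B : Finset G) : Prop :=
  ∃ A', UpperExt E.lt A A' ∧ E.ent A' B

/-- The set `𝒱*` of images of choices of `𝒱`: the unions `⋃_{A ∈ 𝒱} C_A` with `C_A` an inhabited
subset of `A`; equivalently the subsets of `⋃ 𝒱` that meet every member of `𝒱`
(see `choiceImages_empty` and `mem_choiceImages_insert` for the usual recursive description). -/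
noncomputable def choiceImages {G : Type u} (V : Finset (Finset G)) : Finset (Finset G) :=
  (V.biUnion id).powerset.filter fun B => ∀ A ∈ V, (B ∩ A).Nonempty

theorem choiceImages_empty {G : Type u} : choiceImages (∅ : Finset (Finset G)) = {∅} := by
  ext B; simp [choiceImages]

theorem mem_choiceImages_insert {G : Type u} (V : Finset (Finset G)) (A D : Finset G) :
    D ∈ choiceImages (insert A V) ↔ ∃ B ∈ choiceImages V, ∃ C, C ⊆ A ∧ C.Nonempty ∧ D = B ∪ C := by
  simp only [choiceImages, Finset.mem_filter, Finset.mem_powerset, Finset.biUnion_insert, id_eq,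
    Finset.forall_mem_insert]
  constructor
  · rintro ⟨h₁, h₂, h₃⟩
    refine ⟨D ∩ V.biUnion id, ⟨Finset.inter_subset_right, fun A' hA' => ?_⟩, D ∩ A,
      Finset.inter_subset_right, h₂, ?_⟩
    · obtain ⟨x, hx⟩ := h₃ A' hA'
      rw [Finset.mem_inter] at hx
      exact ⟨x, by simp only [Finset.mem_inter, Finset.mem_biUnion]; exact
        ⟨⟨hx.1, A', hA', hx.2⟩, hx.2⟩⟩
    · ext x
      have := @h₁ x
      simp only [Finset.mem_union, Finset.mem_inter] at this ⊢
      tauto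
  · rintro ⟨B, ⟨h₁, h₂⟩, C, hC, ⟨x, hx⟩, rfl⟩
    refine ⟨?_, ⟨x, by simp [hx, hC hx]⟩, fun A' hA' => ?_⟩
    · rw [Finset.union_comm]
      exact Finset.union_subset_union hC h₁
    · exact (h₂ A' hA').mono (Finset.inter_subset_inter_right Finset.subset_union_left)

/-- The cut composition `s · r`. -/
def cutComp {G : Type u} {G' : Type v} {G'' : Type w} (s : Finset G' → Finset G'' → Prop)
    (r : Finset G → Finset G' → Prop) (A : Finset G) (C : Finset G'') : Prop :=
  ∃ V : Finset (Finset G'), (∀ B' ∈ choiceImages V, r A B') ∧ ∀ B ∈ V, s B C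

/-- The extension `r~` of a relation between finite subsets to finite sets of finite subsets. -/
def tildeExt {G : Type u} {G' : Type v} (r : Finset G → Finset G' → Prop)
    (U : Finset (Finset G)) (V : Finset (Finset G')) : Prop :=
  ∀ A ∈ U, ∀ B ∈ choiceImages V, r A B

/-- Proximity maps between strong continuous entailment relations, i.e. Karoubi morphisms
between the associated entailment systems. -/
structure IsProximityMap {G : Type u} {G' : Type v} (E : StrongContEnt G) (E' : StrongContEnt G')
    (r : Finset G → Finset G' → Prop) : Prop where
  upper : ∀ {A B} (A' : Finset G) (B' : Finset G'), r A B → r (A ∪ A') (B ∪ B')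
  comp_left : cutComp E'.ll r = r
  comp_right : cutComp r E.ll = r

/-- Join-preserving proximity maps: the morphisms of the category of strong continuous
entailment relations. -/
structure IsJoinProximityMap {G : Type u} {G' : Type v} (E : StrongContEnt G)
    (E' : StrongContEnt G') (r : Finset G → Finset G' → Prop) : Prop
    extends IsProximityMap E E' r where
  join : ∀ A B, r A B → ∃ U : Finset (Finset G), tildeExt E.ent {A} U ∧
    ∀ A' ∈ U, ∃ b ∈ B, r A' {b}

/-- An isomorphism of strong continuous entailment relations: a pair of mutually inverse
join-preserving proximity maps (the composition is the cut composition, and the identity on `E`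
is `E.ll`). -/
structure StrongContEntIso {G : Type u} {G' : Type v} (E : StrongContEnt G)
    (E' : StrongContEnt G') where
  hom : Finset G → Finset G' → Prop
  inv : Finset G' → Finset G → Prop
  hom_map : IsJoinProximityMap E E' hom
  inv_map : IsJoinProximityMap E' E inv
  inv_comp_hom : cutComp inv hom = E.ll
  hom_comp_inv : cutComp hom inv = E'.ll

/-! ### Generated strong continuous entailment relations -/

theorem IsEntailment.weaken {G : Type u} {E : Finset G → Finset G → Prop} (hE : IsEntailment E)
    {A A' B B' : Finset G} (h : E A B) (hA : A ⊆ A') (hB : B ⊆ B') : E A' B' := by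
  have := hE.mono A' B' h
  rwa [Finset.union_eq_left.2 hA, Finset.union_eq_right.2 hB] at this

theorem IsEntailment.cutSet {G : Type u} {E : Finset G → Finset G → Prop} (hE : IsEntailment E)
    {A D : Finset G} (C : Finset G) (h : E A (D ∪ C)) (hC : ∀ c ∈ C, E ({c} ∪ A) D) :
    E A D := by
  induction C using Finset.induction_on with
  | empty => simpa using h
  | insert c C _ ih =>
    refine ih ?_ fun c' hc' => hC c' (Finset.mem_insert_of_mem hc')
    refine hE.cut c (hE.weaken h subset_rfl ?_)
      (hE.weaken (hC c (Finset.mem_insert_self c C)) subset_rfl Finset.subset_union_left)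
    intro x
    simp only [Finset.mem_union, Finset.mem_insert, Finset.mem_singleton]
    tauto

theorem Generated.interpolate {G : Type u} {ax : Finset G → Finset G → Prop}
    {lt : G → G → Prop}
    (h₀ : ∀ A B C, ax A B → UpperExt lt C A → ∃ B', Generated ax C B' ∧ LowerExt lt B' B)
    {A B : Finset G} (h : Generated ax A B) :
    ∀ C, UpperExt lt C A → ∃ B', Generated ax C B' ∧ LowerExt lt B' B := by
  have hE := Generated.isEntailment ax
  induction h with
  | ax h => exact fun C hC => h₀ _ _ _ h hC
  | refl a =>
    intro C hC
    obtain ⟨c, hc, hca⟩ := hC a (Finset.mem_singleton_self a)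
    refine ⟨{c}, hE.weaken (hE.refl c) (Finset.singleton_subset_iff.2 hc) subset_rfl, ?_⟩
    intro x hx
    rw [Finset.mem_singleton] at hx
    subst hx
    exact ⟨a, Finset.mem_singleton_self a, hca⟩
  | mono A' B' _ ih =>
    intro C hC
    obtain ⟨D, hD, hDB⟩ := ih C fun b hb => hC b (Finset.mem_union_right _ hb)
    exact ⟨D, hD, fun x hx => (hDB x hx).imp fun _ h => ⟨Finset.mem_union_left _ h.1, h.2⟩⟩
  | @cut A B a _ _ ih₁ ih₂ =>
    intro C hC
    obtain ⟨D, hD, hDB⟩ := ih₁ C hC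
    have key : ∀ d : G, lt d a → ∃ X, Generated ax ({d} ∪ C) X ∧ LowerExt lt X B := by
      intro d hd
      refine ih₂ ({d} ∪ C) fun b hb => ?_
      rcases Finset.mem_union.1 hb with hb | hb
      · rw [Finset.mem_singleton] at hb
        subst hb
        exact ⟨d, by simp, hd⟩
      · exact (hC b hb).imp fun _ h => ⟨Finset.mem_union_right _ h.1, h.2⟩
    choose! X hX hXB using key
    refine ⟨D.filter (fun d => ∃ b ∈ B, lt d b) ∪ (D.filter fun d => lt d a).biUnion X, ?_, ?_⟩
    · refine hE.cutSet (D.filter fun d => lt d a) (hE.weaken hD subset_rfl ?_) ?_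
      · intro d hd
        obtain ⟨b, hb, hdb⟩ := hDB d hd
        simp only [Finset.mem_union, Finset.mem_filter, Finset.mem_singleton] at hb ⊢
        rcases hb with hb | rfl
        · exact Or.inl (Or.inl ⟨hd, b, hb, hdb⟩)
        · exact Or.inr ⟨hd, hdb⟩
      · intro d hd
        refine hE.weaken (hX d (Finset.mem_filter.1 hd).2) subset_rfl ?_
        exact (Finset.subset_biUnion_of_mem X hd).trans Finset.subset_union_right
    · intro x hx
      rcases Finset.mem_union.1 hx with hx | hx
      · exact (Finset.mem_filter.1 hx).2
      · obtain ⟨d, hd, hxd⟩ := Finset.mem_biUnion.1 hx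
        exact hXB d (Finset.mem_filter.1 hd).2 x hxd

theorem Generated.swap {G : Type u} {ax ax' : Finset G → Finset G → Prop}
    (hax : ∀ A B, ax A B → ax' B A) {A B : Finset G} (h : Generated ax A B) :
    Generated ax' B A := by
  have hE := Generated.isEntailment ax'
  induction h with
  | ax h => exact Generated.ax (hax _ _ h)
  | refl a => exact hE.refl a
  | mono A' B' _ ih => exact hE.weaken ih Finset.subset_union_left Finset.subset_union_right
  | cut a _ _ ih₁ ih₂ =>
    rw [Finset.union_comm] at ih₁ ih₂
    exact hE.cut a ih₂ ih₁

/-- The strong continuous entailment relation given by a set of axioms and an idempotent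
relation that satisfy the two interpolation conditions. -/
def StrongContEnt.ofAxioms {G : Type u} (ax : Finset G → Finset G → Prop) (lt : G → G → Prop)
    (idem : ∀ a b, (∃ c, lt a c ∧ lt c b) ↔ lt a b)
    (h₁ : ∀ A B C, ax A B → UpperExt lt C A → ∃ B', Generated ax C B' ∧ LowerExt lt B' B)
    (h₂ : ∀ A B C, ax A B → LowerExt lt B C → ∃ A', UpperExt lt A A' ∧ Generated ax A' C) :
    StrongContEnt G where
  ent := Generated ax
  lt := lt
  isEntailment := Generated.isEntailment ax
  idem := idem
  interpolation A B := by
    constructor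
    · rintro ⟨A', hA, hB⟩
      exact hB.interpolate h₁ A hA
    · rintro ⟨B', hA, hB⟩
      have hs : Generated (fun X Y => ax Y X) B' A := hA.swap fun _ _ h => h
      obtain ⟨A', h, h'⟩ := hs.interpolate (lt := fun x y => lt y x) (fun X Y C hXY hC => by
        obtain ⟨A', h, h'⟩ := h₂ Y X C hXY hC
        exact ⟨A', h'.swap fun _ _ h => h, h⟩) B hB
      exact ⟨A', h', h.swap fun _ _ h => h⟩

/-! ### The entailment relations of valuations and covaluations

The generator `(p, a) : ℚ × S` stands for `⟨p, a⟩`. -/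

/-- The finite set `{x, y}`. -/
noncomputable def pair {G : Type u} (x y : G) : Finset G := {x, y}

/-- The axioms of the entailment relation of valuations. -/
inductive ValAx (S : Type u) [StrongProximityLattice S] :
    Finset (ℚ × S) → Finset (ℚ × S) → Prop
  | neg (p : ℚ) (a : S) : p < 0 → ValAx S ∅ {(p, a)}
  | bot (p : ℚ) : 0 < p → ValAx S {(p, ⊥)} ∅
  | mono (p q : ℚ) (a b : S) : q ≤ p → a ≤ b → ValAx S {(p, a)} {(q, b)}
  | mod₁ (p q r s : ℚ) (a b : S) : p + q = r + s →
      ValAx S (pair (p, a) (q, b)) (pair (r, a ⊓ b) (s, a ⊔ b))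
  | mod₂ (p q r s : ℚ) (a b : S) : p + q = r + s →
      ValAx S (pair (r, a ⊓ b) (s, a ⊔ b)) (pair (p, a) (q, b))

/-- The axioms of the entailment relation of covaluations. -/
inductive CovalAx (S : Type u) [StrongProximityLattice S] :
    Finset (ℚ × S) → Finset (ℚ × S) → Prop
  | neg (p : ℚ) (a : S) : p < 0 → CovalAx S {(p, a)} ∅
  | top (p : ℚ) : 0 < p → CovalAx S ∅ {(p, ⊤)}
  | mono (p q : ℚ) (a b : S) : p ≤ q → a ≤ b → CovalAx S {(p, a)} {(q, b)}
  | mod₁ (p q r s : ℚ) (a b : S) : p + q = r + s →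
      CovalAx S (pair (p, a) (q, b)) (pair (r, a ⊓ b) (s, a ⊔ b))
  | mod₂ (p q r s : ℚ) (a b : S) : p + q = r + s →
      CovalAx S (pair (r, a ⊓ b) (s, a ⊔ b)) (pair (p, a) (q, b))

/-- The axioms of the entailment relation of probabilistic valuations. -/
inductive PValAx (S : Type u) [StrongProximityLattice S] :
    Finset (ℚ × S) → Finset (ℚ × S) → Prop
  | val (A B : Finset (ℚ × S)) : ValAx S A B → PValAx S A B
  | le_one (p : ℚ) (a : S) : 1 < p → PValAx S {(p, a)} ∅
  | one_le (p : ℚ) : p < 1 → PValAx S ∅ {(p, ⊤)}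

/-- The axioms of the entailment relation of probabilistic covaluations. -/
inductive PCovalAx (S : Type u) [StrongProximityLattice S] :
    Finset (ℚ × S) → Finset (ℚ × S) → Prop
  | coval (A B : Finset (ℚ × S)) : CovalAx S A B → PCovalAx S A B
  | le_one (p : ℚ) (a : S) : 1 < p → PCovalAx S ∅ {(p, a)}
  | one_le (p : ℚ) : p < 1 → PCovalAx S {(p, ⊥)} ∅

/-- The idempotent relation on the generators of the (probabilistic) valuations. -/
def valLt (S : Type u) [StrongProximityLattice S] (x y : ℚ × S) : Prop :=
  y.1 < x.1 ∧ prec x.2 y.2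

/-- The idempotent relation on the generators of the (probabilistic) covaluations. -/
def covalLt (S : Type u) [StrongProximityLattice S] (x y : ℚ × S) : Prop :=
  x.1 < y.1 ∧ prec x.2 y.2

theorem valLt_idem (S : Type u) [h : StrongProximityLattice S] (x y : ℚ × S) :
    (∃ z, valLt S x z ∧ valLt S z y) ↔ valLt S x y := by
  constructor
  · rintro ⟨z, ⟨h₁, h₂⟩, h₃, h₄⟩
    exact ⟨h₃.trans h₁, (h.idem _ _).1 ⟨_, h₂, h₄⟩⟩
  · rintro ⟨h₁, h₂⟩
    obtain ⟨q, hq, hq'⟩ := exists_between h₁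
    obtain ⟨c, hc, hc'⟩ := (h.idem _ _).2 h₂
    exact ⟨(q, c), ⟨hq', hc⟩, hq, hc'⟩

theorem covalLt_idem (S : Type u) [h : StrongProximityLattice S] (x y : ℚ × S) :
    (∃ z, covalLt S x z ∧ covalLt S z y) ↔ covalLt S x y := by
  constructor
  · rintro ⟨z, ⟨h₁, h₂⟩, h₃, h₄⟩
    exact ⟨h₁.trans h₃, (h.idem _ _).1 ⟨_, h₂, h₄⟩⟩
  · rintro ⟨h₁, h₂⟩
    obtain ⟨q, hq, hq'⟩ := exists_between h₁
    obtain ⟨c, hc, hc'⟩ := (h.idem _ _).2 h₂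
    exact ⟨(q, c), ⟨hq, hc⟩, hq', hc'⟩

theorem lowerExt_singleton {G : Type u} {lt : G → G → Prop} {x y : G} {B : Finset G}
    (hy : y ∈ B) (h : lt x y) : LowerExt lt {x} B := by
  intro z hz
  rw [Finset.mem_singleton] at hz
  exact ⟨y, hy, hz ▸ h⟩

theorem lowerExt_pair {G : Type u} {lt : G → G → Prop} {x y x' y' : G}
    (h : lt x x') (h' : lt y y') : LowerExt lt (pair x y) (pair x' y') := by
  intro z hz
  simp only [pair, Finset.mem_insert, Finset.mem_singleton] at hz ⊢
  rcases hz with rfl | rfl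
  · exact ⟨x', Or.inl rfl, h⟩
  · exact ⟨y', Or.inr rfl, h'⟩

theorem upperExt_pair {G : Type u} {lt : G → G → Prop} {x y : G} {C : Finset G}
    (h : UpperExt lt C (pair x y)) : ∃ x' ∈ C, ∃ y' ∈ C, lt x' x ∧ lt y' y := by
  obtain ⟨x', hx, hx'⟩ := h x (by simp [pair])
  obtain ⟨y', hy, hy'⟩ := h y (by simp [pair])
  exact ⟨x', hx, y', hy, hx', hy'⟩

theorem IsEntailment.pairCut {G : Type u} {E : Finset G → Finset G → Prop} (hE : IsEntailment E)
    {x y x' y' : G} {C B : Finset G} (hx : x ∈ C) (hy : y ∈ C) (hxx : E {x} {x'})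
    (hyy : E {y} {y'}) (h : E (pair x' y') B) : E C B := by
  refine hE.cut x' (hE.weaken hxx (Finset.singleton_subset_iff.2 hx) Finset.subset_union_right) ?_
  refine hE.cut y' (hE.weaken hyy
    (Finset.singleton_subset_iff.2 (Finset.mem_union_right _ hy)) Finset.subset_union_right) ?_
  refine hE.weaken h ?_ subset_rfl
  intro z
  simp only [pair, Finset.mem_insert, Finset.mem_singleton, Finset.mem_union]
  tauto

theorem IsEntailment.pair_sub {G : Type u} {E : Finset G → Finset G → Prop}
    (hE : IsEntailment E) {x y : G} {C B : Finset G} (hx : x ∈ C) (hy : y ∈ C)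
    (h : E (pair x y) B) : E C B :=
  hE.pairCut hx hy (hE.refl x) (hE.refl y) h

theorem ValAx.interpolate (S : Type u) [h : StrongProximityLattice S]
    {E : Finset (ℚ × S) → Finset (ℚ × S) → Prop} (hE : IsEntailment E)
    (hax : ∀ A B, ValAx S A B → E A B) (A B C : Finset (ℚ × S)) (hAB : ValAx S A B)
    (hC : UpperExt (valLt S) C A) : ∃ B', E C B' ∧ LowerExt (valLt S) B' B := by
  have hP := h.isProximity
  cases hAB with
  | neg p a hp =>
    obtain ⟨q, hq, hq'⟩ := exists_between hp
    exact ⟨{(q, ⊥)}, hE.weaken (hax _ _ (ValAx.neg q ⊥ hq')) (Finset.empty_subset _) subset_rfl,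
      lowerExt_singleton (Finset.mem_singleton_self _) ⟨hq, hP.bot_left a⟩⟩
  | bot p hp =>
    obtain ⟨⟨q, b⟩, hq, hq', hb⟩ := hC _ (Finset.mem_singleton_self _)
    obtain rfl := h.prox_zero _ hb
    exact ⟨∅, hE.weaken (hax _ _ (ValAx.bot q (hp.trans hq')))
      (Finset.singleton_subset_iff.2 hq) subset_rfl, fun x hx => by simp at hx⟩
  | mono p q a b hqp hab =>
    obtain ⟨⟨p', a'⟩, hm, hp', ha'⟩ := hC _ (Finset.mem_singleton_self _)
    exact ⟨{(p', a')}, hE.weaken (hE.refl _) (Finset.singleton_subset_iff.2 hm) subset_rfl,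
      lowerExt_singleton (Finset.mem_singleton_self _)
        ⟨hqp.trans_lt hp', hP.upper_right hab ha'⟩⟩
  | mod₁ p q r s a b hs =>
    obtain ⟨⟨p', a'⟩, hx, ⟨q', b'⟩, hy, ⟨hp, ha⟩, hq, hb⟩ := upperExt_pair hC
    have hp : p < p' := hp
    have hq : q < q' := hq
    have ha : prec a' a := ha
    have hb : prec b' b := hb
    refine ⟨pair (r + (p' - p), a' ⊓ b') (s + (q' - q), a' ⊔ b'), hE.pair_sub hx hy
      (hax _ _ (ValAx.mod₁ _ _ _ _ _ _ (by linarith))), lowerExt_pair ⟨?_, ?_⟩ ⟨?_, ?_⟩⟩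
    · change r < r + (p' - p); linarith
    · exact hP.inf_right (hP.lower_left inf_le_left ha) (hP.lower_left inf_le_right hb)
    · change s < s + (q' - q); linarith
    · exact hP.sup_left (hP.upper_right le_sup_left ha) (hP.upper_right le_sup_right hb)
  | mod₂ p q r s a b hs =>
    obtain ⟨⟨r', c⟩, hx, ⟨s', d⟩, hy, ⟨hr, hc⟩, hs', hd⟩ := upperExt_pair hC
    have hr : r < r' := hr
    have hs' : s < s' := hs'
    have hc : prec c (a ⊓ b) := hc
    obtain ⟨a', b', hd', ha', hb'⟩ := h.prox_sup d a b hd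
    refine ⟨pair (p + (r' - r), a' ⊔ c) (q + (s' - s), b' ⊔ c), hE.pairCut hx hy
      (hax _ _ (ValAx.mono _ r' _ ((a' ⊔ c) ⊓ (b' ⊔ c)) le_rfl
        (le_inf le_sup_right le_sup_right)))
      (hax _ _ (ValAx.mono _ s' _ ((a' ⊔ c) ⊔ (b' ⊔ c)) le_rfl
        (hd'.trans (sup_le_sup le_sup_left le_sup_left))))
      (hax _ _ (ValAx.mod₂ _ _ _ _ _ _ (by linarith))), lowerExt_pair ⟨?_, ?_⟩ ⟨?_, ?_⟩⟩
    · change p < p + (r' - r); linarith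
    · exact hP.sup_left ha' (hP.upper_right inf_le_left hc)
    · change q < q + (s' - s); linarith
    · exact hP.sup_left hb' (hP.upper_right inf_le_right hc)

theorem CovalAx.interpolate (S : Type u) [h : StrongProximityLattice S]
    {E : Finset (ℚ × S) → Finset (ℚ × S) → Prop} (hE : IsEntailment E)
    (hax : ∀ A B, CovalAx S A B → E A B) (A B C : Finset (ℚ × S)) (hAB : CovalAx S A B)
    (hC : UpperExt (covalLt S) C A) : ∃ B', E C B' ∧ LowerExt (covalLt S) B' B := by
  have hP := h.isProximity
  cases hAB with
  | neg p a hp =>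
    obtain ⟨⟨q, b⟩, hq, hq', hb⟩ := hC _ (Finset.mem_singleton_self _)
    have hq' : q < p := hq'
    exact ⟨∅, hE.weaken (hax _ _ (CovalAx.neg q b (hq'.trans hp)))
      (Finset.singleton_subset_iff.2 hq) subset_rfl, fun x hx => by simp at hx⟩
  | top p hp =>
    obtain ⟨q, hq, hq'⟩ := exists_between hp
    exact ⟨{(q, ⊤)}, hE.weaken (hax _ _ (CovalAx.top q hq)) (Finset.empty_subset _) subset_rfl,
      lowerExt_singleton (Finset.mem_singleton_self _) ⟨hq', hP.top_right ⊤⟩⟩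
  | mono p q a b hqp hab =>
    obtain ⟨⟨p', a'⟩, hm, hp', ha'⟩ := hC _ (Finset.mem_singleton_self _)
    exact ⟨{(p', a')}, hE.weaken (hE.refl _) (Finset.singleton_subset_iff.2 hm) subset_rfl,
      lowerExt_singleton (Finset.mem_singleton_self _)
        ⟨hp'.trans_le hqp, hP.upper_right hab ha'⟩⟩
  | mod₁ p q r s a b hs =>
    obtain ⟨⟨p', a'⟩, hx, ⟨q', b'⟩, hy, ⟨hp, ha⟩, hq, hb⟩ := upperExt_pair hC
    have hp : p' < p := hp
    have hq : q' < q := hq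
    have ha : prec a' a := ha
    have hb : prec b' b := hb
    refine ⟨pair (r + (p' - p), a' ⊓ b') (s + (q' - q), a' ⊔ b'), hE.pair_sub hx hy
      (hax _ _ (CovalAx.mod₁ _ _ _ _ _ _ (by linarith))), lowerExt_pair ⟨?_, ?_⟩ ⟨?_, ?_⟩⟩
    · change r + (p' - p) < r; linarith
    · exact hP.inf_right (hP.lower_left inf_le_left ha) (hP.lower_left inf_le_right hb)
    · change s + (q' - q) < s; linarith
    · exact hP.sup_left (hP.upper_right le_sup_left ha) (hP.upper_right le_sup_right hb)
  | mod₂ p q r s a b hs =>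
    obtain ⟨⟨r', c⟩, hx, ⟨s', d⟩, hy, ⟨hr, hc⟩, hs', hd⟩ := upperExt_pair hC
    have hr : r' < r := hr
    have hs' : s' < s := hs'
    have hc : prec c (a ⊓ b) := hc
    obtain ⟨a', b', hd', ha', hb'⟩ := h.prox_sup d a b hd
    refine ⟨pair (p + (r' - r), a' ⊔ c) (q + (s' - s), b' ⊔ c), hE.pairCut hx hy
      (hax _ _ (CovalAx.mono _ r' _ ((a' ⊔ c) ⊓ (b' ⊔ c)) le_rfl
        (le_inf le_sup_right le_sup_right)))
      (hax _ _ (CovalAx.mono _ s' _ ((a' ⊔ c) ⊔ (b' ⊔ c)) le_rfl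
        (hd'.trans (sup_le_sup le_sup_left le_sup_left))))
      (hax _ _ (CovalAx.mod₂ _ _ _ _ _ _ (by linarith))), lowerExt_pair ⟨?_, ?_⟩ ⟨?_, ?_⟩⟩
    · change p + (r' - r) < p; linarith
    · exact hP.sup_left ha' (hP.upper_right inf_le_left hc)
    · change q + (s' - s) < q; linarith
    · exact hP.sup_left hb' (hP.upper_right inf_le_right hc)

theorem pair_comm {G : Type u} (x y : G) : pair x y = pair y x := Finset.pair_comm x y

/-- Reversing the axioms of valuations gives axioms of covaluations on the opposite lattice. -/
theorem ValAx.swap (S : Type u) [StrongProximityLattice S] {A B : Finset (ℚ × S)}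
    (h : ValAx S A B) : CovalAx Sᵒᵈ B A := by
  cases h with
  | neg p a hp => exact CovalAx.neg (S := Sᵒᵈ) p a hp
  | bot p hp => exact CovalAx.top (S := Sᵒᵈ) p hp
  | mono p q a b hpq hab => exact CovalAx.mono (S := Sᵒᵈ) q p b a hpq hab
  | mod₁ p q r s a b hs =>
    rw [pair_comm (r, a ⊓ b)]
    exact CovalAx.mod₂ (S := Sᵒᵈ) p q s r a b (by linarith)
  | mod₂ p q r s a b hs =>
    rw [pair_comm (r, a ⊓ b)]
    exact CovalAx.mod₁ (S := Sᵒᵈ) p q s r a b (by linarith)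

/-- Reversing the axioms of covaluations gives axioms of valuations on the opposite lattice. -/
theorem CovalAx.swap (S : Type u) [StrongProximityLattice S] {A B : Finset (ℚ × S)}
    (h : CovalAx S A B) : ValAx Sᵒᵈ B A := by
  cases h with
  | neg p a hp => exact ValAx.neg (S := Sᵒᵈ) p a hp
  | top p hp => exact ValAx.bot (S := Sᵒᵈ) p hp
  | mono p q a b hpq hab => exact ValAx.mono (S := Sᵒᵈ) q p b a hpq hab
  | mod₁ p q r s a b hs =>
    rw [pair_comm (r, a ⊓ b)]
    exact ValAx.mod₂ (S := Sᵒᵈ) p q s r a b (by linarith)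
  | mod₂ p q r s a b hs =>
    rw [pair_comm (r, a ⊓ b)]
    exact ValAx.mod₁ (S := Sᵒᵈ) p q s r a b (by linarith)

theorem IsEntailment.swap {G : Type u} {E : Finset G → Finset G → Prop} (hE : IsEntailment E) :
    IsEntailment fun A B => E B A :=
  { refl := hE.refl
    mono := fun _ _ h => hE.weaken h Finset.subset_union_left Finset.subset_union_right
    cut := fun a h h' => by
      rw [Finset.union_comm] at h h'
      exact hE.cut a h' h }

theorem ValAx.interpolate' (S : Type u) [StrongProximityLattice S]
    {E : Finset (ℚ × S) → Finset (ℚ × S) → Prop} (hE : IsEntailment E)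
    (hax : ∀ A B, ValAx S A B → E A B) (A B C : Finset (ℚ × S)) (hAB : ValAx S A B)
    (hC : LowerExt (valLt S) B C) : ∃ A', UpperExt (valLt S) A A' ∧ E A' C := by
  obtain ⟨A', h₁, h₂⟩ := CovalAx.interpolate Sᵒᵈ (E := fun X Y => E Y X) hE.swap
    (fun X Y hXY => hax Y X (CovalAx.swap Sᵒᵈ hXY)) B A C (ValAx.swap S hAB) hC
  exact ⟨A', h₂, h₁⟩

theorem CovalAx.interpolate' (S : Type u) [StrongProximityLattice S]
    {E : Finset (ℚ × S) → Finset (ℚ × S) → Prop} (hE : IsEntailment E)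
    (hax : ∀ A B, CovalAx S A B → E A B) (A B C : Finset (ℚ × S)) (hAB : CovalAx S A B)
    (hC : LowerExt (covalLt S) B C) : ∃ A', UpperExt (covalLt S) A A' ∧ E A' C := by
  obtain ⟨A', h₁, h₂⟩ := ValAx.interpolate Sᵒᵈ (E := fun X Y => E Y X) hE.swap
    (fun X Y hXY => hax Y X (ValAx.swap Sᵒᵈ hXY)) B A C (CovalAx.swap S hAB) hC
  exact ⟨A', h₂, h₁⟩

/-- The strong continuous entailment relation of valuations on `S`. -/
def valEnt (S : Type u) [StrongProximityLattice S] : StrongContEnt (ℚ × S) :=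
  StrongContEnt.ofAxioms (ValAx S) (valLt S) (valLt_idem S)
    (ValAx.interpolate S (Generated.isEntailment _) fun _ _ => Generated.ax)
    (ValAx.interpolate' S (Generated.isEntailment _) fun _ _ => Generated.ax)

/-- The strong continuous entailment relation of covaluations on `S`. -/
def covalEnt (S : Type u) [StrongProximityLattice S] : StrongContEnt (ℚ × S) :=
  StrongContEnt.ofAxioms (CovalAx S) (covalLt S) (covalLt_idem S)
    (CovalAx.interpolate S (Generated.isEntailment _) fun _ _ => Generated.ax)
    (CovalAx.interpolate' S (Generated.isEntailment _) fun _ _ => Generated.ax)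

theorem PValAx.interpolate (S : Type u) [h : StrongProximityLattice S]
    {E : Finset (ℚ × S) → Finset (ℚ × S) → Prop} (hE : IsEntailment E)
    (hax : ∀ A B, PValAx S A B → E A B) (A B C : Finset (ℚ × S)) (hAB : PValAx S A B)
    (hC : UpperExt (valLt S) C A) : ∃ B', E C B' ∧ LowerExt (valLt S) B' B := by
  cases hAB with
  | val _ _ hv =>
    exact ValAx.interpolate S hE (fun _ _ h => hax _ _ (PValAx.val _ _ h)) A B C hv hC
  | le_one p a hp =>
    obtain ⟨⟨q, b⟩, hq, hq', hb⟩ := hC _ (Finset.mem_singleton_self _)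
    exact ⟨∅, hE.weaken (hax _ _ (PValAx.le_one q b (hp.trans hq')))
      (Finset.singleton_subset_iff.2 hq) subset_rfl, fun x hx => by simp at hx⟩
  | one_le p hp =>
    obtain ⟨q, hq, hq'⟩ := exists_between hp
    exact ⟨{(q, ⊤)}, hE.weaken (hax _ _ (PValAx.one_le q hq')) (Finset.empty_subset _) subset_rfl,
      lowerExt_singleton (Finset.mem_singleton_self _) ⟨hq, h.isProximity.top_right ⊤⟩⟩

theorem PCovalAx.interpolate (S : Type u) [h : StrongProximityLattice S]
    {E : Finset (ℚ × S) → Finset (ℚ × S) → Prop} (hE : IsEntailment E)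
    (hax : ∀ A B, PCovalAx S A B → E A B) (A B C : Finset (ℚ × S)) (hAB : PCovalAx S A B)
    (hC : UpperExt (covalLt S) C A) : ∃ B', E C B' ∧ LowerExt (covalLt S) B' B := by
  cases hAB with
  | coval _ _ hv =>
    exact CovalAx.interpolate S hE (fun _ _ h => hax _ _ (PCovalAx.coval _ _ h)) A B C hv hC
  | le_one p a hp =>
    obtain ⟨q, hq, hq'⟩ := exists_between hp
    exact ⟨{(q, ⊥)}, hE.weaken (hax _ _ (PCovalAx.le_one q ⊥ hq)) (Finset.empty_subset _)
      subset_rfl,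
      lowerExt_singleton (Finset.mem_singleton_self _) ⟨hq', h.isProximity.bot_left a⟩⟩
  | one_le p hp =>
    obtain ⟨⟨q, b⟩, hq, hq', hb⟩ := hC _ (Finset.mem_singleton_self _)
    obtain rfl := h.prox_zero _ hb
    exact ⟨∅, hE.weaken (hax _ _ (PCovalAx.one_le q (lt_trans hq' hp)))
      (Finset.singleton_subset_iff.2 hq) subset_rfl, fun x hx => by simp at hx⟩

theorem PValAx.swap (S : Type u) [StrongProximityLattice S] {A B : Finset (ℚ × S)}
    (h : PValAx S A B) : PCovalAx Sᵒᵈ B A := by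
  cases h with
  | val _ _ h => exact PCovalAx.coval (S := Sᵒᵈ) _ _ (ValAx.swap S h)
  | le_one p a hp => exact PCovalAx.le_one (S := Sᵒᵈ) p a hp
  | one_le p hp => exact PCovalAx.one_le (S := Sᵒᵈ) p hp

theorem PCovalAx.swap (S : Type u) [StrongProximityLattice S] {A B : Finset (ℚ × S)}
    (h : PCovalAx S A B) : PValAx Sᵒᵈ B A := by
  cases h with
  | coval _ _ h => exact PValAx.val (S := Sᵒᵈ) _ _ (CovalAx.swap S h)
  | le_one p a hp => exact PValAx.le_one (S := Sᵒᵈ) p a hp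
  | one_le p hp => exact PValAx.one_le (S := Sᵒᵈ) p hp

theorem PValAx.interpolate' (S : Type u) [StrongProximityLattice S]
    {E : Finset (ℚ × S) → Finset (ℚ × S) → Prop} (hE : IsEntailment E)
    (hax : ∀ A B, PValAx S A B → E A B) (A B C : Finset (ℚ × S)) (hAB : PValAx S A B)
    (hC : LowerExt (valLt S) B C) : ∃ A', UpperExt (valLt S) A A' ∧ E A' C := by
  obtain ⟨A', h₁, h₂⟩ := PCovalAx.interpolate Sᵒᵈ (E := fun X Y => E Y X) hE.swap
    (fun X Y hXY => hax Y X (PCovalAx.swap Sᵒᵈ hXY)) B A C (PValAx.swap S hAB) hC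
  exact ⟨A', h₂, h₁⟩

theorem PCovalAx.interpolate' (S : Type u) [StrongProximityLattice S]
    {E : Finset (ℚ × S) → Finset (ℚ × S) → Prop} (hE : IsEntailment E)
    (hax : ∀ A B, PCovalAx S A B → E A B) (A B C : Finset (ℚ × S)) (hAB : PCovalAx S A B)
    (hC : LowerExt (covalLt S) B C) : ∃ A', UpperExt (covalLt S) A A' ∧ E A' C := by
  obtain ⟨A', h₁, h₂⟩ := PValAx.interpolate Sᵒᵈ (E := fun X Y => E Y X) hE.swap
    (fun X Y hXY => hax Y X (PValAx.swap Sᵒᵈ hXY)) B A C (PCovalAx.swap S hAB) hC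
  exact ⟨A', h₂, h₁⟩

/-- The strong continuous entailment relation of probabilistic valuations on `S`. -/
def pvalEnt (S : Type u) [StrongProximityLattice S] : StrongContEnt (ℚ × S) :=
  StrongContEnt.ofAxioms (PValAx S) (valLt S) (valLt_idem S)
    (PValAx.interpolate S (Generated.isEntailment _) fun _ _ => Generated.ax)
    (PValAx.interpolate' S (Generated.isEntailment _) fun _ _ => Generated.ax)

/-- The strong continuous entailment relation of probabilistic covaluations on `S`. -/
def pcovalEnt (S : Type u) [StrongProximityLattice S] : StrongContEnt (ℚ × S) :=
  StrongContEnt.ofAxioms (PCovalAx S) (covalLt S) (covalLt_idem S)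
    (PCovalAx.interpolate S (Generated.isEntailment _) fun _ _ => Generated.ax)
    (PCovalAx.interpolate' S (Generated.isEntailment _) fun _ _ => Generated.ax)

/-! ### Locales presented by geometric theories -/

/-- A geometric theory over the generators `G`: a set of axioms `(A, 𝓑)`, read
`⋀ A ⊢ ⋁_{B ∈ 𝓑} ⋀ B`. -/
abbrev GeometricTheory (G : Type u) := Set (Finset G × Set (Finset G))

/-- Interpretations of a geometric theory in (the locale with) a frame `L`. -/
def IsInterpretation {G : Type u} {L : Type v} [Order.Frame L] (T : GeometricTheory G)
    (f : G → L) : Prop :=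
  ∀ x ∈ T, x.1.inf f ≤ ⨆ B ∈ x.2, B.inf f

/-- The frame of the locale presented by `T`. Its elements are the families `U` of finite sets of
generators (`A ∈ U` meaning `⋀ A ≤ U`) that are upward closed and closed under the covers given by
the axioms. It has the universal property of the frame presented by `T`,
see `Opens.universal`. -/
@[ext]
structure Opens {G : Type u} (T : GeometricTheory G) where
  carrier : Set (Finset G)
  upper : ∀ {A B}, A ⊆ B → A ∈ carrier → B ∈ carrier
  closed : ∀ x ∈ T, ∀ C, x.1 ⊆ C → (∀ B ∈ x.2, C ∪ B ∈ carrier) → C ∈ carrier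

namespace Opens

variable {G : Type u} {T : GeometricTheory G}

instance : PartialOrder (Opens T) := PartialOrder.lift carrier fun _ _ => Opens.ext

theorem le_def {U V : Opens T} : U ≤ V ↔ U.carrier ⊆ V.carrier := Iff.rfl

instance : InfSet (Opens T) where
  sInf K :=
    { carrier := {A | ∀ U ∈ K, A ∈ U.carrier}
      upper := fun hAB hA U hU => U.upper hAB (hA U hU)
      closed := fun x hx C hC h U hU => U.closed x hx C hC fun B hB => h B hB U hU }

instance : CompleteLattice (Opens T) where
  __ := completeLatticeOfInf (Opens T) fun _ =>
    ⟨fun _ hU _ hA => hA _ hU, fun _ hV _ hA _ hU => hV hU hA⟩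
  top := ⟨Set.univ, fun _ _ => trivial, fun _ _ _ _ _ => trivial⟩
  le_top _ _ _ := trivial
  inf U V :=
    { carrier := U.carrier ∩ V.carrier
      upper := fun hAB hA => ⟨U.upper hAB hA.1, V.upper hAB hA.2⟩
      closed := fun x hx C hC h => ⟨U.closed x hx C hC fun B hB => (h B hB).1,
        V.closed x hx C hC fun B hB => (h B hB).2⟩ }
  inf_le_left _ _ _ hA := hA.1
  inf_le_right _ _ _ hA := hA.2
  le_inf _ _ _ h₁ h₂ _ hA := ⟨h₁ hA, h₂ hA⟩

/-- The Heyting implication, in the guise used to prove distributivity. -/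
def imp (U V : Opens T) : Opens T where
  carrier := {A | ∀ B, A ⊆ B → B ∈ U.carrier → B ∈ V.carrier}
  upper hAB hA _ hC := hA _ (hAB.trans hC)
  closed x hx _ hC h B hCB hB := V.closed x hx B (hC.trans hCB) fun D hD =>
    h D hD (B ∪ D) (Finset.union_subset_union_left hCB) (U.upper Finset.subset_union_left hB)

instance : Order.Frame (Opens T) :=
  Order.Frame.ofMinimalAxioms
    { inf_sSup_le_iSup_inf := fun U K => by
        have h : sSup K ≤ imp U (⨆ V ∈ K, U ⊓ V) := by
          refine sSup_le fun V hV A hA B hAB hB => ?_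
          exact le_def.1 (le_iSup₂ (f := fun V (_ : V ∈ K) => U ⊓ V) V hV) ⟨hB, V.upper hAB hA⟩
        exact fun A hA => h hA.2 A subset_rfl hA.1 }

/-- The open given by a finite set `A` of generators, i.e. the least open containing `A`. -/
def basic (T : GeometricTheory G) (A : Finset G) : Opens T := sInf {U | A ∈ U.carrier}

theorem basic_le {A : Finset G} {U : Opens T} : basic T A ≤ U ↔ A ∈ U.carrier :=
  ⟨fun h => h fun _ hU => hU, fun h => sInf_le h⟩

/-- The universal interpretation of the generators. -/
def gen (T : GeometricTheory G) (x : G) : Opens T := basic T {x}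

/-- The open `{C | C ∪ D ∈ W}`. -/
def shift (W : Opens T) (D : Finset G) : Opens T where
  carrier := {C | C ∪ D ∈ W.carrier}
  upper hAB hA := W.upper (Finset.union_subset_union_left hAB) hA
  closed x hx C hC h := W.closed x hx (C ∪ D) (hC.trans Finset.subset_union_left) fun B hB => by
    rw [Finset.union_right_comm]
    exact h B hB

theorem basic_union (A D : Finset G) : basic T (A ∪ D) = basic T A ⊓ basic T D := by
  refine le_antisymm (le_inf ?_ ?_) ?_
  · exact basic_le.2 ((basic T A).upper Finset.subset_union_left (basic_le.1 le_rfl))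
  · exact basic_le.2 ((basic T D).upper Finset.subset_union_right (basic_le.1 le_rfl))
  · rintro B ⟨hA, hD⟩
    have h₁ : basic T A ≤ shift (basic T (A ∪ D)) D :=
      basic_le.2 (show A ∪ D ∈ (basic T (A ∪ D)).carrier from basic_le.1 le_rfl)
    have h₂ : basic T D ≤ shift (basic T (A ∪ D)) B := by
      refine basic_le.2 (show D ∪ B ∈ (basic T (A ∪ D)).carrier from ?_)
      rw [Finset.union_comm D B]
      exact h₁ hA
    have h₃ : B ∪ B ∈ (basic T (A ∪ D)).carrier := h₂ hD
    rwa [Finset.union_self] at h₃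

theorem basic_empty : basic T ∅ = ⊤ :=
  top_unique fun A _ => (basic T ∅).upper (Finset.empty_subset A) (basic_le.1 le_rfl)

theorem inf_gen (A : Finset G) : A.inf (gen T) = basic T A := by
  induction A using Finset.induction_on with
  | empty => rw [Finset.inf_empty, basic_empty]
  | insert a A _ ih => rw [Finset.inf_insert, ih, gen, ← basic_union, Finset.insert_eq]

theorem gen_isInterpretation (T : GeometricTheory G) : IsInterpretation T (gen T) := by
  intro x hx
  simp only [inf_gen]
  refine basic_le.2 (Opens.closed _ x hx _ subset_rfl fun B hB => ?_)
  exact Opens.upper _ Finset.subset_union_right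
    (basic_le.1 (le_iSup₂ (f := fun B (_ : B ∈ x.2) => basic T B) B hB))

theorem eq_iSup_basic (U : Opens T) : U = ⨆ A ∈ U.carrier, basic T A :=
  le_antisymm (fun A hA => basic_le.1 (le_iSup₂ (f := fun A (_ : A ∈ U.carrier) => basic T A) A hA))
    (iSup₂_le fun _ hA => basic_le.2 hA)

/-- The open `{A | ⋀ f(A) ≤ y}` for an interpretation `f`. -/
def below {L : Type v} [Order.Frame L] {f : G → L} (hf : IsInterpretation T f) (y : L) :
    Opens T where
  carrier := {A | A.inf f ≤ y}
  upper hAB hA := (Finset.inf_mono hAB).trans hA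
  closed x hx C hC h := by
    have h₁ : C.inf f ≤ C.inf f ⊓ ⨆ B ∈ x.2, B.inf f :=
      le_inf le_rfl ((Finset.inf_mono hC).trans (hf x hx))
    refine h₁.trans ?_
    simp only [inf_iSup_eq]
    refine iSup₂_le fun B hB => ?_
    rw [← Finset.inf_union]
    exact h B hB

/-- The extension of an interpretation to a frame homomorphism. -/
def lift {L : Type v} [Order.Frame L] {f : G → L} (hf : IsInterpretation T f) :
    FrameHom (Opens T) L where
  toFun U := ⨆ A ∈ U.carrier, A.inf f
  map_inf' U V := by
    refine le_antisymm (le_inf ?_ ?_) ?_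
    · exact iSup₂_le fun A hA => le_iSup₂ (f := fun A (_ : A ∈ U.carrier) => A.inf f) A hA.1
    · exact iSup₂_le fun A hA => le_iSup₂ (f := fun A (_ : A ∈ V.carrier) => A.inf f) A hA.2
    · simp only [iSup_inf_eq, inf_iSup_eq]
      refine iSup₂_le fun A hA => iSup₂_le fun B hB => ?_
      rw [← Finset.inf_union]
      refine le_iSup₂ (f := fun A (_ : A ∈ (U ⊓ V).carrier) => A.inf f) _ ⟨?_, ?_⟩
      · exact U.upper Finset.subset_union_left hB
      · exact V.upper Finset.subset_union_right hA
  map_top' := top_unique <|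
    le_iSup₂_of_le (f := fun A (_ : A ∈ (⊤ : Opens T).carrier) => A.inf f) ∅ trivial
      (by rw [Finset.inf_empty])
  map_sSup' K := by
    refine le_antisymm ?_ (sSup_le ?_)
    · refine iSup₂_le fun A hA => ?_
      have h : sSup K ≤ below hf (sSup ((fun U : Opens T => ⨆ A ∈ U.carrier, A.inf f) '' K)) :=
        sSup_le fun U hU B hB =>
          (le_iSup₂ (f := fun A (_ : A ∈ U.carrier) => A.inf f) B hB).trans
            (le_sSup (Set.mem_image_of_mem _ hU))
      exact h hA
    · rintro _ ⟨U, hU, rfl⟩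
      exact biSup_mono fun A hA => le_def.1 (le_sSup hU) hA

/-- The universal property of the presented frame. -/
theorem universal (T : GeometricTheory G) {L : Type v} [Order.Frame L] (f : G → L)
    (hf : IsInterpretation T f) : ∃! g : FrameHom (Opens T) L, ∀ x, g (gen T x) = f x := by
  refine ⟨lift hf, fun x => le_antisymm ?_ ?_, fun g hg => ?_⟩
  · refine iSup₂_le fun A hA => ?_
    have h : gen T x ≤ below hf (f x) :=
      basic_le.2 (show Finset.inf {x} f ≤ f x by rw [Finset.inf_singleton])
    exact h hA
  · refine le_iSup₂_of_le (f := fun A (_ : A ∈ (gen T x).carrier) => A.inf f) {x}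
      (basic_le.1 le_rfl) ?_
    rw [Finset.inf_singleton]
  · refine DFunLike.ext _ _ fun U => ?_
    change g U = ⨆ A ∈ U.carrier, A.inf f
    conv_lhs => rw [eq_iSup_basic U]
    simp only [map_iSup, ← inf_gen, map_finset_inf]
    exact iSup_congr fun A => iSup_congr fun _ => Finset.inf_congr rfl fun x _ => hg x

end Opens

/-- The frame of the de Groot dual of a locale with frame `L`: the Scott open filters of `L`,
ordered by inclusion. -/
abbrev ScottOpenFilter (L : Type u) [Order.Frame L] : Type u :=
  {F : Order.PFilter L // ∀ D : Set L, D.Nonempty → DirectedOn (· ≤ ·) D → sSup D ∈ F →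
    ∃ d ∈ D, d ∈ F}

/-! ### The spaces of valuations and covaluations -/

/-- The axioms of the geometric theory of valuations; `(p, a)` says that the value of `a` is
greater than `p`. -/
inductive ValThAx (S : Type u) [StrongProximityLattice S] :
    Finset (ℚ × S) → Set (Finset (ℚ × S)) → Prop
  | neg (p : ℚ) (a : S) : p < 0 → ValThAx S ∅ {{(p, a)}}
  | bot (p : ℚ) : 0 < p → ValThAx S {(p, ⊥)} ∅
  | mono (p q : ℚ) (a b : S) : q ≤ p → a ≤ b → ValThAx S {(p, a)} {{(q, b)}}
  | mod₁ (p q : ℚ) (a b : S) : ValThAx S (pair (p, a) (q, b))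
      {B | ∃ p' q', p' + q' = p + q ∧ B = pair (p', a ⊓ b) (q', a ⊔ b)}
  | mod₂ (p q : ℚ) (a b : S) : ValThAx S (pair (p, a ⊓ b) (q, a ⊔ b))
      {B | ∃ p' q', p' + q' = p + q ∧ B = pair (p', a) (q', b)}
  | approx (p q : ℚ) (a b : S) : q < p → prec a b → ValThAx S {(p, a)} {{(q, b)}}
  | round (p : ℚ) (a : S) : ValThAx S {(p, a)} {B | ∃ q b, p < q ∧ prec b a ∧ B = {(q, b)}}

/-- The axioms of the geometric theory of covaluations; `(p, a)` says that the value of `a` is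
less than `p`. -/
inductive CovalThAx (S : Type u) [StrongProximityLattice S] :
    Finset (ℚ × S) → Set (Finset (ℚ × S)) → Prop
  | neg (p : ℚ) (a : S) : p < 0 → CovalThAx S {(p, a)} ∅
  | top (p : ℚ) : 0 < p → CovalThAx S ∅ {{(p, ⊤)}}
  | mono (p q : ℚ) (a b : S) : p ≤ q → a ≤ b → CovalThAx S {(p, a)} {{(q, b)}}
  | mod₁ (p q : ℚ) (a b : S) : CovalThAx S (pair (p, a) (q, b))
      {B | ∃ p' q', p' + q' = p + q ∧ B = pair (p', a ⊓ b) (q', a ⊔ b)}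
  | mod₂ (p q : ℚ) (a b : S) : CovalThAx S (pair (p, a ⊓ b) (q, a ⊔ b))
      {B | ∃ p' q', p' + q' = p + q ∧ B = pair (p', a) (q', b)}
  | approx (p q : ℚ) (a b : S) : p < q → prec a b → CovalThAx S {(p, a)} {{(q, b)}}
  | round (p : ℚ) (a : S) : CovalThAx S {(p, a)} {B | ∃ q b, q < p ∧ prec b a ∧ B = {(q, b)}}

/-- The axioms of the geometric theory of probabilistic valuations (`μ ⊤ = 1`). -/
inductive PValThAx (S : Type u) [StrongProximityLattice S] :
    Finset (ℚ × S) → Set (Finset (ℚ × S)) → Prop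
  | val (A : Finset (ℚ × S)) (B : Set (Finset (ℚ × S))) : ValThAx S A B → PValThAx S A B
  | le_one (p : ℚ) (a : S) : 1 < p → PValThAx S {(p, a)} ∅
  | one_le (p : ℚ) : p < 1 → PValThAx S ∅ {{(p, ⊤)}}

/-- The axioms of the geometric theory of probabilistic covaluations (`ν ⊥ = 1`). -/
inductive PCovalThAx (S : Type u) [StrongProximityLattice S] :
    Finset (ℚ × S) → Set (Finset (ℚ × S)) → Prop
  | coval (A : Finset (ℚ × S)) (B : Set (Finset (ℚ × S))) : CovalThAx S A B → PCovalThAx S A B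
  | le_one (p : ℚ) (a : S) : 1 < p → PCovalThAx S ∅ {{(p, a)}}
  | one_le (p : ℚ) : p < 1 → PCovalThAx S {(p, ⊥)} ∅

/-- The frame of the space of valuations on the locale `Spec S` of `S`, presented
by its geometric theory. -/
abbrev ValSpace (S : Type u) [StrongProximityLattice S] : Type u :=
  Opens ({x | ValThAx S x.1 x.2} : GeometricTheory (ℚ × S))

/-- The frame of the space of covaluations on the locale `Spec S` of `S`, presented
by its geometric theory. -/
abbrev CovalSpace (S : Type u) [StrongProximityLattice S] : Type u :=
  Opens ({x | CovalThAx S x.1 x.2} : GeometricTheory (ℚ × S))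

/-- The frame of the space of probabilistic valuations on the locale `Spec S` of `S`, presented
by its geometric theory. -/
abbrev PValSpace (S : Type u) [StrongProximityLattice S] : Type u :=
  Opens ({x | PValThAx S x.1 x.2} : GeometricTheory (ℚ × S))

/-- The frame of the space of probabilistic covaluations on the locale `Spec S` of `S`, presented
by its geometric theory. -/
abbrev PCovalSpace (S : Type u) [StrongProximityLattice S] : Type u :=
  Opens ({x | PCovalThAx S x.1 x.2} : GeometricTheory (ℚ × S))

end DeGroot

open DeGroot

namespace DeGroot

open scoped Classical

/-! ### The identity isomorphism of a strong continuous entailment relation -/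

/-! Parts 1 and 2 hold on the nose. Passing to the opposite lattice exchanges meets and joins, hence
the two modular axioms, and reversing any other axiom of valuations gives an axiom of covaluations;
the order on ℚ already runs in opposite directions for the two kinds. So the dual of one relation
equals the other relation over `Sᵒᵈ`, and the required isomorphism is an identity `≪`. That `≪` is
idempotent under cut composition follows from cut and interpolation.

Parts 3 and 4 combine a general duality with a comparison of presentations.

Duality (`StrongContEnt.scottOpenFilterIso`): let the locale of a strong continuous entailment
relation be the one presented by its rounded models. Entailments have finite conclusions, so a
finite meet of generators is way below any meet of generators that it approximates
(`exists_mem_of_upperExt`), and an inequality between a finite meet and a finite join of generators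
comes from an entailment up to one rounding (`ll_of_inf_gen_le_sup_gen`). By Scott openness and
finite distributivity, a Scott open filter is determined by the finite joins of generators that it
contains (`Opens.exists_sup_gen_mem`). Read as finite meets of dual generators, these joins form an
open of the dual relation, and conversely every such open generates a Scott open filter.

Comparison (`isInterpretation_val_iff` and its analogues): the geometric theories state modularity
with a disjunction over all splittings of a sum, the entailment relations with a binary disjunction
for each splitting. The first form gives the second by monotonicity. The converse uses roundedness,
which opens a gap between two sums, and an Archimedean walk along the splittings that crosses this
gap step by step (`le_sup_add_nsmul`). Both theories then have the same interpretations in every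
frame, hence the same opens. -/

theorem IsEntailment.cutLeft {G : Type u} {E : Finset G → Finset G → Prop} (hE : IsEntailment E)
    {A X : Finset G} (C : Finset G) (h : E (C ∪ A) X) (hC : ∀ c ∈ C, E A (X ∪ {c})) : E A X := by
  rw [Finset.union_comm] at h
  refine hE.swap.cutSet C h fun c hc => ?_
  have := hC c hc
  rwa [Finset.union_comm] at this

/-- Cut along a finite set of finite sets. -/
theorem IsEntailment.cutChoice {G : Type u} {E : Finset G → Finset G → Prop}
    (hE : IsEntailment E) {A : Finset G} (V : Finset (Finset G)) :
    ∀ D : Finset G, (∀ B ∈ choiceImages V, E A (B ∪ D)) → (∀ B ∈ V, E B D) → E A D := by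
  induction V using Finset.induction_on with
  | empty =>
    intro D h _
    simpa using h ∅ (by simp [choiceImages_empty])
  | insert A₀ V _ ih =>
    intro D h h'
    refine ih D (fun B hB => ?_) fun B hB => h' B (Finset.mem_insert_of_mem hB)
    -- Adding any `c ∈ A₀` to the choice `B` of `V` gives a choice of the enlarged family, so `A`
    -- entails `B ∪ D` together with `c`. Since `A₀` entails `D`, all of `A₀` is cut out at once.
    refine hE.cutLeft A₀ (hE.weaken (h' A₀ (Finset.mem_insert_self _ _))
      Finset.subset_union_left Finset.subset_union_right) fun c hc => ?_
    rw [Finset.union_right_comm]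
    exact h _ ((mem_choiceImages_insert V A₀ _).2
      ⟨B, hB, {c}, Finset.singleton_subset_iff.2 hc, Finset.singleton_nonempty c, rfl⟩)

theorem LowerExt.trans {G : Type u} {lt : G → G → Prop}
    (hlt : ∀ a b, (∃ c, lt a c ∧ lt c b) → lt a b) {A B C : Finset G}
    (h : LowerExt lt A B) (h' : LowerExt lt B C) : LowerExt lt A C := fun a ha => by
  obtain ⟨b, hb, hab⟩ := h a ha
  obtain ⟨c, hc, hbc⟩ := h' b hb
  exact ⟨c, hc, hlt _ _ ⟨b, hab, hbc⟩⟩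

theorem LowerExt.interpolate {G : Type u} {lt : G → G → Prop}
    (hlt : ∀ a b, lt a b → ∃ c, lt a c ∧ lt c b) {A C : Finset G}
    (h : LowerExt lt A C) : ∃ B, LowerExt lt A B ∧ LowerExt lt B C := by
  choose! g hg hlg using h
  have key : ∀ a ∈ A, ∃ c, lt a c ∧ lt c (g a) := fun a ha => hlt _ _ (hlg a ha)
  choose! m hm hm' using key
  refine ⟨A.image m, fun a ha => ⟨m a, Finset.mem_image_of_mem m ha, hm a ha⟩, fun b hb => ?_⟩
  obtain ⟨a, ha, rfl⟩ := Finset.mem_image.1 hb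
  exact ⟨g a, hg a ha, hm' a ha⟩

theorem LowerExt.biUnion {G : Type u} {ι : Type v} {lt : G → G → Prop} {s : Finset ι}
    {f : ι → Finset G} {B : Finset G} (h : ∀ i ∈ s, LowerExt lt (f i) B) :
    LowerExt lt (s.biUnion f) B := fun x hx => by
  obtain ⟨i, hi, hx⟩ := Finset.mem_biUnion.1 hx
  exact h i hi x hx

namespace StrongContEnt

variable {G : Type u} (E : StrongContEnt G)

theorem lowerExt_trans {A B C : Finset G} (h : LowerExt E.lt A B) (h' : LowerExt E.lt B C) :
    LowerExt E.lt A C :=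
  h.trans (fun a b => (E.idem a b).1) h'

theorem lowerExt_interpolate {A C : Finset G} (h : LowerExt E.lt A C) :
    ∃ B, LowerExt E.lt A B ∧ LowerExt E.lt B C :=
  h.interpolate fun a b => (E.idem a b).2

theorem ll_iff {A B : Finset G} : E.ll A B ↔ ∃ B', E.ent A B' ∧ LowerExt E.lt B' B :=
  E.interpolation A B

theorem ll_upper {A B : Finset G} (A' B' : Finset G) (h : E.ll A B) :
    E.ll (A ∪ A') (B ∪ B') := by
  obtain ⟨C, hC, hCB⟩ := h
  exact ⟨C, fun c hc => (hC c hc).imp fun _ h => ⟨Finset.mem_union_left _ h.1, h.2⟩,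
    E.isEntailment.weaken hCB subset_rfl Finset.subset_union_left⟩

theorem ll_singleton {a b : G} (h : E.lt a b) : E.ll {a} {b} :=
  E.ll_iff.2 ⟨{a}, E.isEntailment.refl a, lowerExt_singleton (Finset.mem_singleton_self b) h⟩

/-- Lets a single finite set serve as the middle term of a cut composition: decomposed into
singletons, it leaves no freedom of choice. -/
theorem choiceImages_singletons (A : Finset G) : choiceImages (A.image fun a => {a}) = {A} := by
  ext B
  simp only [choiceImages, Finset.mem_filter, Finset.mem_powerset, Finset.mem_singleton,
    Finset.forall_mem_image]
  constructor
  · rintro ⟨h, h'⟩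
    refine Finset.Subset.antisymm (fun x hx => ?_) fun x hx => ?_
    · simpa using h hx
    · obtain ⟨y, hy⟩ := h' hx
      rw [Finset.mem_inter, Finset.mem_singleton] at hy
      exact hy.2 ▸ hy.1
  · rintro rfl
    refine ⟨fun x hx => by simpa using hx, fun x hx => ⟨x, by simpa using hx⟩⟩

/-- A cut composite unfolds to `A ≺_U ⋃ X ⊢ ⋃ Y ≺_L C`, the middle entailment being a cut along `V`;
interpolation moves the left rounding to the right, where transitivity absorbs it. Conversely, the
final `≺_L` is interpolated and the middle set is split into singletons. -/
theorem ll_comp_ll : cutComp E.ll E.ll = E.ll := by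
  funext A C
  refine propext ⟨?_, fun h => ?_⟩
  · rintro ⟨V, hV, hVC⟩
    simp only [ll_iff] at hVC
    choose! X hX hX' using hV
    choose! Y hY hY' using hVC
    have h₁ : UpperExt E.lt A ((choiceImages V).biUnion X) := fun x hx => by
      obtain ⟨B, hB, hx⟩ := Finset.mem_biUnion.1 hx
      exact hX B hB x hx
    have h₂ : LowerExt E.lt (V.biUnion Y) C := LowerExt.biUnion hY'
    have h₃ : E.ent ((choiceImages V).biUnion X) (V.biUnion Y) := by
      refine E.isEntailment.cutChoice V _ (fun B hB => ?_) fun B hB => ?_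
      · exact E.isEntailment.weaken (hX' B hB) (Finset.subset_biUnion_of_mem X hB)
          Finset.subset_union_left
      · exact E.isEntailment.weaken (hY B hB) subset_rfl (Finset.subset_biUnion_of_mem Y hB)
    obtain ⟨Z, hZ, hZ'⟩ := E.ll_iff.1 ⟨_, h₁, h₃⟩
    exact E.ll_iff.2 ⟨Z, hZ, E.lowerExt_trans hZ' h₂⟩
  · obtain ⟨C', hC, hC'⟩ := E.ll_iff.1 h
    obtain ⟨D, hD, hD'⟩ := E.lowerExt_interpolate hC'
    refine ⟨D.image fun d => {d}, fun B hB => ?_, fun B hB => ?_⟩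
    · rw [choiceImages_singletons, Finset.mem_singleton] at hB
      exact hB ▸ E.ll_iff.2 ⟨C', hC, hD⟩
    · obtain ⟨d, hd, rfl⟩ := Finset.mem_image.1 hB
      obtain ⟨c, hc, hdc⟩ := hD' d hd
      exact E.ll_iff.2 ⟨{d}, E.isEntailment.refl d, lowerExt_singleton hc hdc⟩

theorem isJoinProximityMap_ll : IsJoinProximityMap E E E.ll where
  upper A' B' h := E.ll_upper A' B' h
  comp_left := E.ll_comp_ll
  comp_right := E.ll_comp_ll
  join A B h := by
    obtain ⟨B', hB, hB'⟩ := E.ll_iff.1 h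
    refine ⟨B'.image fun b => {b}, fun A' hA' C hC => ?_, fun C hC => ?_⟩
    · rw [choiceImages_singletons, Finset.mem_singleton] at hC
      rw [Finset.mem_singleton] at hA'
      exact hA' ▸ hC ▸ hB
    · obtain ⟨b, hb, rfl⟩ := Finset.mem_image.1 hC
      exact (hB' b hb).imp fun _ h => ⟨h.1, E.ll_singleton h.2⟩

/-- The identity isomorphism. -/
def isoRefl : StrongContEntIso E E where
  hom := E.ll
  inv := E.ll
  hom_map := E.isJoinProximityMap_ll
  inv_map := E.isJoinProximityMap_ll
  inv_comp_hom := E.ll_comp_ll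
  hom_comp_inv := E.ll_comp_ll

variable {E} in
theorem ext_ent_lt {E' : StrongContEnt G} (h : ∀ A B, E.ent A B ↔ E'.ent A B)
    (h' : ∀ a b, E.lt a b ↔ E'.lt a b) : E = E' := by
  have h₁ : E.ent = E'.ent := funext₂ fun A B => propext (h A B)
  have h₂ : E.lt = E'.lt := funext₂ fun a b => propext (h' a b)
  cases E
  cases E'
  cases h₁
  cases h₂
  rfl

end StrongContEnt

/-! ### Duality of the entailment relations -/

/-- An equality is possible because `S` and `Sᵒᵈ` have the same elements: the generators coincide,
the two `≺` agree by definition, and a derivation reverses rule by rule. -/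
theorem dual_valEnt (S : Type u) [StrongProximityLattice S] :
    (valEnt S).dual = covalEnt Sᵒᵈ :=
  StrongContEnt.ext_ent_lt
    (fun _ _ => ⟨Generated.swap fun _ _ => ValAx.swap S, Generated.swap fun _ _ => CovalAx.swap Sᵒᵈ⟩)
    fun _ _ => Iff.rfl

theorem dual_covalEnt (S : Type u) [StrongProximityLattice S] :
    (covalEnt S).dual = valEnt Sᵒᵈ :=
  StrongContEnt.ext_ent_lt
    (fun _ _ => ⟨Generated.swap fun _ _ => CovalAx.swap S, Generated.swap fun _ _ => ValAx.swap Sᵒᵈ⟩)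
    fun _ _ => Iff.rfl

theorem dual_pvalEnt (S : Type u) [StrongProximityLattice S] :
    (pvalEnt S).dual = pcovalEnt Sᵒᵈ :=
  StrongContEnt.ext_ent_lt
    (fun _ _ => ⟨Generated.swap fun _ _ => PValAx.swap S,
      Generated.swap fun _ _ => PCovalAx.swap Sᵒᵈ⟩)
    fun _ _ => Iff.rfl

theorem dual_pcovalEnt (S : Type u) [StrongProximityLattice S] :
    (pcovalEnt S).dual = pvalEnt Sᵒᵈ :=
  StrongContEnt.ext_ent_lt
    (fun _ _ => ⟨Generated.swap fun _ _ => PCovalAx.swap S,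
      Generated.swap fun _ _ => PValAx.swap Sᵒᵈ⟩)
    fun _ _ => Iff.rfl

/-! ### Distributivity over choices -/

/-- The extra element `z` accumulates the generators already selected, which makes the induction on
`V` go through. -/
theorem inf_sup_le_of_choiceImages {G : Type u} {L : Type v} [DistribLattice L] [BoundedOrder L]
    (f : G → L) (y : L) (V : Finset (Finset G)) :
    ∀ z : L, (∀ A ∈ choiceImages V, z ⊓ A.inf f ≤ y) → z ⊓ V.inf (fun B => B.sup f) ≤ y := by
  induction V using Finset.induction_on with
  | empty =>
    intro z h
    simpa using h ∅ (by simp [choiceImages_empty])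
  | insert A₀ V _ ih =>
    intro z h
    rw [Finset.inf_insert, ← inf_assoc, Finset.sup_inf_distrib_left, Finset.sup_inf_distrib_right]
    refine Finset.sup_le fun a ha => ih _ fun A hA => ?_
    have := h (A ∪ {a}) ((mem_choiceImages_insert V A₀ _).2
      ⟨A, hA, {a}, Finset.singleton_subset_iff.2 ha, Finset.singleton_nonempty a, rfl⟩)
    rwa [Finset.inf_union, Finset.inf_singleton, inf_comm (A.inf f), ← inf_assoc] at this

/-- The finite distributive law. A choice may take several elements from one set, but this only
lowers its meet. -/
theorem inf_sup_le_iff {G : Type u} {L : Type v} [DistribLattice L] [BoundedOrder L]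
    {f : G → L} {y : L} {V : Finset (Finset G)} :
    V.inf (fun B => B.sup f) ≤ y ↔ ∀ A ∈ choiceImages V, A.inf f ≤ y := by
  refine ⟨fun h A hA => le_trans (Finset.le_inf fun B hB => ?_) h, fun h => ?_⟩
  · obtain ⟨x, hx⟩ := (Finset.mem_filter.1 hA).2 B hB
    rw [Finset.mem_inter] at hx
    exact (Finset.inf_le hx.1).trans (Finset.le_sup hx.2)
  · have := inf_sup_le_of_choiceImages f y V ⊤ fun A hA => by simpa using h A hA
    simpa using this

theorem le_sup_inf_iff {G : Type u} {L : Type v} [DistribLattice L] [BoundedOrder L]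
    {f : G → L} {y : L} {V : Finset (Finset G)} :
    y ≤ V.sup (fun B => B.inf f) ↔ ∀ A ∈ choiceImages V, y ≤ A.sup f :=
  inf_sup_le_iff (L := Lᵒᵈ) (f := f) (y := y)

/-! ### The locale of a strong continuous entailment relation -/

/-- The axioms of the geometric theory of the rounded models of a strong continuous entailment
relation. -/
inductive SpecAx {G : Type u} (E : StrongContEnt G) : Finset G → Set (Finset G) → Prop
  | ent (A B : Finset G) : E.ent A B → SpecAx E A {C | ∃ b ∈ B, C = {b}}
  | approx (a b : G) : E.lt a b → SpecAx E {a} {{b}}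
  | round (a : G) : SpecAx E {a} {C | ∃ b, E.lt b a ∧ C = {b}}

/-- The geometric theory of the rounded models of a strong continuous entailment relation. -/
def StrongContEnt.theory {G : Type u} (E : StrongContEnt G) : GeometricTheory G :=
  {x | SpecAx E x.1 x.2}

namespace StrongContEnt

variable {G : Type u} {E : StrongContEnt G}

theorem mem_of_specAx (U : Opens E.theory) {A C : Finset G} {𝓑 : Set (Finset G)}
    (h : SpecAx E A 𝓑) (hA : A ⊆ C) (hB : ∀ B ∈ 𝓑, C ∪ B ∈ U.carrier) : C ∈ U.carrier :=
  U.closed (A, 𝓑) h C hA hB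

theorem mem_of_ent (U : Opens E.theory) {A B C : Finset G} (h : E.ent A B) (hA : A ⊆ C)
    (hB : ∀ b ∈ B, C ∪ {b} ∈ U.carrier) : C ∈ U.carrier :=
  mem_of_specAx U (SpecAx.ent A B h) hA fun _ ⟨b, hb, hD⟩ => hD ▸ hB b hb

/-- Start from `D ∪ C` and discard the elements of `C` one by one: each has some `d ∈ D` with `d ≺
c`, so an approximation axiom makes it redundant. -/
theorem mem_of_upperExt (U : Opens E.theory) {C D : Finset G} (h : UpperExt E.lt D C)
    (hC : C ∈ U.carrier) : D ∈ U.carrier := by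
  suffices H : ∀ C : Finset G, UpperExt E.lt D C → D ∪ C ∈ U.carrier → D ∈ U.carrier from
    H C h (U.upper Finset.subset_union_right hC)
  intro C
  induction C using Finset.induction_on with
  | empty => intro _ h; simpa using h
  | insert c C _ ih =>
    intro h hC
    refine ih (fun c' hc' => h c' (Finset.mem_insert_of_mem hc')) ?_
    obtain ⟨d, hd, hdc⟩ := h c (Finset.mem_insert_self c C)
    refine mem_of_specAx U (SpecAx.approx d c hdc)
      (Finset.singleton_subset_iff.2 (Finset.mem_union_left _ hd)) fun B hB => ?_
    obtain rfl : B = {c} := hB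
    rwa [Finset.union_assoc, Finset.union_comm C, ← Finset.insert_eq]

/-- The rounding axiom replaces the elements of `C` one at a time by arbitrary approximations; `K`
collects those already substituted. With `mem_of_upperExt`, membership in an open is thus decided by
approximations alone. -/
theorem mem_of_forall_upperExt (U : Opens E.theory) {C : Finset G}
    (h : ∀ D, UpperExt E.lt D C → D ∈ U.carrier) : C ∈ U.carrier := by
  suffices H : ∀ C K : Finset G, (∀ D, UpperExt E.lt D C → K ∪ D ∈ U.carrier) →
      K ∪ C ∈ U.carrier by
    simpa using H C ∅ (by simpa using h)
  intro C
  induction C using Finset.induction_on with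
  | empty => exact fun K h => h ∅ fun c hc => absurd hc (Finset.notMem_empty c)
  | insert a C _ ih =>
    intro K h
    refine mem_of_specAx U (SpecAx.round a) (Finset.singleton_subset_iff.2
      (Finset.mem_union_right _ (Finset.mem_insert_self a C))) ?_
    rintro _ ⟨b, hb, rfl⟩
    refine U.upper (A := (K ∪ {b}) ∪ C) ?_ (ih (K ∪ {b}) fun D hD => ?_)
    · intro x
      simp only [Finset.mem_union, Finset.mem_insert]
      tauto
    · rw [Finset.union_assoc]
      refine h _ fun c hc => ?_
      rcases Finset.mem_insert.1 hc with rfl | hc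
      · exact ⟨b, by simp, hb⟩
      · exact (hD c hc).imp fun _ h => ⟨Finset.mem_union_right _ h.1, h.2⟩

/-- The open of those `C` all of whose approximations satisfy a property that is stable
under cut. -/
def roundOpen (E : StrongContEnt G) (P : Finset G → Prop)
    (hP : ∀ D B, E.ent D B → (∀ b ∈ B, P (D ∪ {b})) → P D) : Opens E.theory where
  carrier := {C | ∀ D, UpperExt E.lt D C → P D}
  upper hAB hA D hD := hA D fun a ha => hD a (hAB ha)
  closed x hx C hC h D hD := by
    obtain ⟨A, 𝓑⟩ := x
    change SpecAx E A 𝓑 at hx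
    cases hx with
    | ent A B hAB =>
      -- Interpolation trades `D ≺_U A ⊢ B` for `D ⊢ B' ≺_L B`, so stability of `P` under cut is
      -- needed only at `D` and `B'`.
      obtain ⟨B', hDB, hB⟩ := E.ll_iff.1 ⟨A, fun a ha => hD a (hC ha), hAB⟩
      refine hP D B' hDB fun b' hb' => ?_
      obtain ⟨b, hb, hlt⟩ := hB b' hb'
      refine h {b} ⟨b, hb, rfl⟩ _ fun c hc => ?_
      rcases Finset.mem_union.1 hc with hc | hc
      · exact (hD c hc).imp fun _ h => ⟨Finset.mem_union_left _ h.1, h.2⟩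
      · exact ⟨b', by simp, Finset.mem_singleton.1 hc ▸ hlt⟩
    | approx a b hab =>
      refine h {b} rfl D fun c hc => ?_
      rcases Finset.mem_union.1 hc with hc | hc
      · exact hD c hc
      · obtain ⟨d, hd, hda⟩ := hD a (hC (Finset.mem_singleton_self a))
        exact ⟨d, hd, Finset.mem_singleton.1 hc ▸ (E.idem d b).1 ⟨a, hda, hab⟩⟩
    | round a =>
      obtain ⟨d, hd, hda⟩ := hD a (hC (Finset.mem_singleton_self a))
      obtain ⟨b, hdb, hba⟩ := (E.idem d a).2 hda
      refine h {b} ⟨b, hba, rfl⟩ D fun c hc => ?_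
      rcases Finset.mem_union.1 hc with hc | hc
      · exact hD c hc
      · exact ⟨d, hd, Finset.mem_singleton.1 hc ▸ hdb⟩

/-! ### Inequalities between meets and joins of generators, and compactness -/

theorem inf_gen_le {A : Finset G} {U : Opens E.theory} :
    A.inf (Opens.gen E.theory) ≤ U ↔ A ∈ U.carrier := by
  rw [Opens.inf_gen, Opens.basic_le]

theorem gen_le_of_lt {a b : G} (h : E.lt a b) :
    Opens.gen E.theory a ≤ Opens.gen E.theory b :=
  Opens.basic_le.2 (mem_of_upperExt _ (C := {b}) (fun x hx =>
    ⟨a, by simp, Finset.mem_singleton.1 hx ▸ h⟩) (Opens.basic_le.1 le_rfl))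

theorem sup_gen_mono {A B : Finset G} (h : LowerExt E.lt A B) :
    A.sup (Opens.gen E.theory) ≤ B.sup (Opens.gen E.theory) :=
  Finset.sup_le fun a ha => by
    obtain ⟨b, hb, hab⟩ := h a ha
    exact (gen_le_of_lt hab).trans (Finset.le_sup hb)

theorem gen_le_iSup (a : G) :
    Opens.gen E.theory a ≤ ⨆ b, ⨆ (_ : E.lt b a), Opens.gen E.theory b := by
  refine Opens.basic_le.2 (mem_of_forall_upperExt _ fun D hD => ?_)
  obtain ⟨d, hd, hda⟩ := hD a (Finset.mem_singleton_self a)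
  refine Opens.upper _ (Finset.singleton_subset_iff.2 hd) (Opens.basic_le.1 ?_)
  exact le_iSup₂ (f := fun b (_ : E.lt b a) => Opens.gen E.theory b) d hda

theorem inf_gen_le_sup_gen {A B : Finset G} (h : E.ent A B) :
    A.inf (Opens.gen E.theory) ≤ B.sup (Opens.gen E.theory) :=
  inf_gen_le.2 (mem_of_ent _ h subset_rfl fun _ hb => Opens.upper _ Finset.subset_union_right
    (Opens.basic_le.1 (Finset.le_sup (f := Opens.gen E.theory) hb)))

/-- Conservativity up to rounding. The sets all of whose approximations are `≪ B` form an open, by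
cut; it contains each generator in `B`, hence lies above `⋁ B` and so above `⋀ A`. -/
theorem ll_of_inf_gen_le_sup_gen {A A' B : Finset G}
    (h : A.inf (Opens.gen E.theory) ≤ B.sup (Opens.gen E.theory)) (hA : UpperExt E.lt A' A) :
    E.ll A' B := by
  have hP : ∀ D C, E.ent D C → (∀ c ∈ C, E.ll (D ∪ {c}) B) → E.ll D B := by
    intro D C hDC hC
    simp only [ll_iff] at hC ⊢
    choose! X hX hX' using hC
    refine ⟨C.biUnion X, ?_, LowerExt.biUnion hX'⟩
    refine E.isEntailment.cutSet C (E.isEntailment.weaken hDC subset_rfl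
      Finset.subset_union_right) fun c hc => ?_
    rw [Finset.union_comm]
    exact E.isEntailment.weaken (hX c hc) subset_rfl (Finset.subset_biUnion_of_mem X hc)
  have hB : B.sup (Opens.gen E.theory) ≤ roundOpen E (fun D => E.ll D B) hP := by
    refine Finset.sup_le fun b hb => Opens.basic_le.2 fun D hD => ?_
    obtain ⟨d, hd, hdb⟩ := hD b (Finset.mem_singleton_self b)
    exact E.ll_iff.2 ⟨{d}, E.isEntailment.weaken (E.isEntailment.refl d)
      (Finset.singleton_subset_iff.2 hd) subset_rfl, lowerExt_singleton hb hdb⟩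
  exact inf_gen_le.1 (h.trans hB) A' hA

/-- Says that `⋀ A'` is way below `⋀ A`. The sets all of whose approximations lie in some member of
`𝓓` form an open: an entailment has finitely many conclusions, so directedness supplies one member
that serves them all. This open lies above every member of `𝓓`. -/
theorem exists_mem_of_upperExt {𝓓 : Set (Opens E.theory)} (hne : 𝓓.Nonempty)
    (hdir : DirectedOn (· ≤ ·) 𝓓) {A A' : Finset G} (hA : A ∈ (sSup 𝓓).carrier)
    (hA' : UpperExt E.lt A' A) : ∃ U ∈ 𝓓, A' ∈ U.carrier := by
  have hP : ∀ D B, E.ent D B → (∀ b ∈ B, ∃ U ∈ 𝓓, D ∪ {b} ∈ U.carrier) →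
      ∃ U ∈ 𝓓, D ∈ U.carrier := by
    intro D B hDB hB
    choose! W hW hW' using hB
    obtain ⟨U, hU, hU'⟩ : ∃ U ∈ 𝓓, ∀ b ∈ B, W b ≤ U := by
      obtain ⟨U, hU, h⟩ := Finset.sup_le_of_le_directed 𝓓 hne hdir (B.image W) (by
        simpa using fun b hb => ⟨W b, hW b hb, le_rfl⟩)
      exact ⟨U, hU, fun b hb =>
        (Finset.le_sup (f := id) (Finset.mem_image_of_mem W hb)).trans h⟩
    exact ⟨U, hU, mem_of_ent U hDB subset_rfl fun b hb => hU' b hb (hW' b hb)⟩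
  have h : sSup 𝓓 ≤ roundOpen E (fun D => ∃ U ∈ 𝓓, D ∈ U.carrier) hP :=
    sSup_le fun U hU C hC D hD => ⟨U, hU, mem_of_upperExt U hD hC⟩
  exact h hA A' hA'

end StrongContEnt

/-! ### The de Groot dual of the locale of a strong continuous entailment relation -/

/-- `U` is the directed join of its finite joins of basic opens, so Scott openness puts one of these
in `F`. By distributivity it is a finite meet of finite joins of generators, each of them larger and
hence also in `F`. -/
theorem Opens.exists_sup_gen_mem {G : Type u} {T : GeometricTheory G}
    (F : ScottOpenFilter (Opens T)) {U : Opens T} (hU : U ∈ F.1) :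
    ∃ V : Finset (Finset G), (∀ B ∈ V, B.sup (gen T) ∈ F.1) ∧
      V.inf (fun B => B.sup (gen T)) ≤ U := by
  have hle : ∀ W : Finset (Finset G), ↑W ⊆ U.carrier → W.sup (fun A => A.inf (gen T)) ≤ U :=
    fun W hW => Finset.sup_le fun A hA => by rw [inf_gen, basic_le]; exact hW hA
  have hsup : U ≤ sSup ((fun W : Finset (Finset G) => W.sup fun A => A.inf (gen T)) ''
      {W | ↑W ⊆ U.carrier}) := fun A hA => basic_le.1 (by
    rw [← inf_gen]
    exact le_sSup ⟨{A}, by simpa using hA, Finset.sup_singleton⟩)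
  obtain ⟨_, ⟨W, hW, rfl⟩, hWF⟩ := F.2
    ((fun W : Finset (Finset G) => W.sup fun A => A.inf (gen T)) '' {W | ↑W ⊆ U.carrier})
    ⟨_, ∅, by simp, rfl⟩ (by
      rintro _ ⟨W, hW, rfl⟩ _ ⟨W', hW', rfl⟩
      refine ⟨_, ⟨W ∪ W', ?_, rfl⟩, Finset.sup_mono Finset.subset_union_left,
        Finset.sup_mono Finset.subset_union_right⟩
      simpa using ⟨hW, hW'⟩) (Order.PFilter.mem_of_le hsup hU)
  exact ⟨choiceImages W, fun B hB => Order.PFilter.mem_of_le (le_sup_inf_iff.1 le_rfl B hB) hWF,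
    (le_sup_inf_iff.2 fun B hB => Finset.inf_le hB).trans (hle W hW)⟩

namespace StrongContEnt

variable {G : Type u} {E : StrongContEnt G}

/-- Roundedness writes `⋁ B` as the directed join of the `⋁ A` with `A ≺_L B`; Scott openness
selects one. -/
theorem exists_lowerExt_sup_gen_mem (F : ScottOpenFilter (Opens E.theory)) {B : Finset G}
    (hB : B.sup (Opens.gen E.theory) ∈ F.1) :
    ∃ A, LowerExt E.lt A B ∧ A.sup (Opens.gen E.theory) ∈ F.1 := by
  have hsup : B.sup (Opens.gen E.theory) ≤
      sSup ((fun A : Finset G => A.sup (Opens.gen E.theory)) '' {A | LowerExt E.lt A B}) :=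
    Finset.sup_le fun b hb => (gen_le_iSup b).trans (iSup₂_le fun c hc =>
      le_sSup ⟨{c}, lowerExt_singleton hb hc, Finset.sup_singleton⟩)
  obtain ⟨_, ⟨A, hA, rfl⟩, hAF⟩ := F.2
    ((fun A : Finset G => A.sup (Opens.gen E.theory)) '' {A | LowerExt E.lt A B})
    ⟨_, ∅, fun x hx => absurd hx (Finset.notMem_empty x), rfl⟩ (by
      rintro _ ⟨A, hA, rfl⟩ _ ⟨A', hA', rfl⟩
      refine ⟨_, ⟨A ∪ A', fun x hx => ?_, rfl⟩, Finset.sup_mono Finset.subset_union_left,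
        Finset.sup_mono Finset.subset_union_right⟩
      exact (Finset.mem_union.1 hx).elim (hA x) (hA' x)) (Order.PFilter.mem_of_le hsup hB)
  exact ⟨A, hA, hAF⟩

/-- The open of the dual that corresponds to a Scott open filter. -/
def dualOpen (F : ScottOpenFilter (Opens E.theory)) : Opens E.dual.theory :=
  roundOpen E.dual (fun D => D.sup (Opens.gen E.theory) ∈ F.1) fun D B hDB hB => by
    -- The meet over `b ∈ B` of `⋁ D ⊔ b` is `⋁ D ⊔ ⋀ B`, and `⋀ B ≤ ⋁ D` because the dual
    -- entailment from `D` to `B` is `B ⊢ D`.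
    have h : B.inf (fun b => (D ∪ {b}).sup (Opens.gen E.theory)) ∈ F.1 := by
      clear hDB
      induction B using Finset.induction_on with
      | empty => exact Order.PFilter.top_mem
      | insert b B _ ih =>
        rw [Finset.inf_insert]
        exact Order.PFilter.inf_mem (hB b (Finset.mem_insert_self b B))
          (ih fun b' hb' => hB b' (Finset.mem_insert_of_mem hb'))
    refine Order.PFilter.mem_of_le ?_ h
    simp only [Finset.sup_union, Finset.sup_singleton]
    rw [← Finset.inf_sup_distrib_left]
    exact sup_le le_rfl (inf_gen_le_sup_gen hDB)

theorem mem_dualOpen {F : ScottOpenFilter (Opens E.theory)} {C : Finset G} :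
    C ∈ (dualOpen F).carrier ↔
      ∀ D, LowerExt E.lt C D → D.sup (Opens.gen E.theory) ∈ F.1 := Iff.rfl

/-- `B` is an open neighbourhood of the compact saturated set given by an open of the dual. -/
def IsNhd (V : Opens E.dual.theory) (B : Finset G) : Prop :=
  ∃ C ∈ V.carrier, LowerExt E.lt C B

theorem IsNhd.interpolate {V : Opens E.dual.theory} {B : Finset G} (h : IsNhd V B) :
    ∃ A, IsNhd V A ∧ LowerExt E.lt A B := by
  obtain ⟨C, hC, hCB⟩ := h
  obtain ⟨A, hCA, hAB⟩ := E.lowerExt_interpolate hCB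
  exact ⟨A, ⟨C, hC, hCA⟩, hAB⟩

theorem IsNhd.mem {V : Opens E.dual.theory} {B : Finset G} (h : IsNhd V B) : B ∈ V.carrier :=
  let ⟨_, hC, hCB⟩ := h
  mem_of_upperExt V hCB hC

/-- A finite family of neighbourhoods can be shrunk. -/
theorem exists_refinement {V : Opens E.dual.theory} {𝓦 : Finset (Finset G)}
    (h : ∀ B ∈ 𝓦, IsNhd V B) : ∃ 𝓦' : Finset (Finset G), (∀ B ∈ 𝓦', IsNhd V B) ∧
      ∀ A' ∈ choiceImages 𝓦', ∃ A ∈ choiceImages 𝓦, UpperExt E.lt A' A := by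
  choose! g hg hg' using fun B hB => (h B hB).interpolate
  refine ⟨𝓦.image g, by simpa using hg, fun A' hA' => ?_⟩
  have key : ∀ B ∈ 𝓦, ∃ y ∈ B, ∃ x ∈ A', E.lt x y := fun B hB => by
    obtain ⟨x, hx⟩ := (Finset.mem_filter.1 hA').2 _ (Finset.mem_image_of_mem g hB)
    rw [Finset.mem_inter] at hx
    obtain ⟨y, hy, hxy⟩ := hg' B hB x hx.2
    exact ⟨y, hy, x, hx.1, hxy⟩
  -- The choice consists of every element of `⋃ 𝓦` that some member of `A'` approximates; `key`
  -- shows that it meets each `B ∈ 𝓦`.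
  refine ⟨(𝓦.biUnion id).filter fun y => ∃ x ∈ A', E.lt x y,
    Finset.mem_filter.2 ⟨Finset.mem_powerset.2 (Finset.filter_subset _ _), fun B hB => ?_⟩,
    fun y hy => (Finset.mem_filter.1 hy).2⟩
  obtain ⟨y, hy, h⟩ := key B hB
  exact ⟨y, Finset.mem_inter.2 ⟨Finset.mem_filter.2 ⟨Finset.mem_biUnion.2 ⟨B, hB, hy⟩, h⟩, hy⟩⟩

theorem isPFilter_dualFilter (V : Opens E.dual.theory) :
    Order.IsPFilter {U : Opens E.theory | ∃ 𝓦 : Finset (Finset G), (∀ B ∈ 𝓦, IsNhd V B) ∧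
      𝓦.inf (fun B => B.sup (Opens.gen E.theory)) ≤ U} := by
  refine Order.IsPFilter.of_def ⟨⊤, ∅, by simp, le_top⟩ ?_ ?_
  · rintro U ⟨𝓦, h, hU⟩ U' ⟨𝓦', h', hU'⟩
    refine ⟨U ⊓ U', ⟨𝓦 ∪ 𝓦', fun B hB => (Finset.mem_union.1 hB).elim (h B) (h' B), ?_⟩,
      inf_le_left, inf_le_right⟩
    rw [Finset.inf_union]
    exact inf_le_inf hU hU'
  · rintro U U' hUU' ⟨𝓦, h, hU⟩
    exact ⟨𝓦, h, hU.trans hUU'⟩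

/-- The Scott open filter that corresponds to an open of the dual. -/
def dualFilter (V : Opens E.dual.theory) : ScottOpenFilter (Opens E.theory) :=
  ⟨(isPFilter_dualFilter V).toPFilter, by
    rintro 𝓓 hne hdir ⟨𝓦, h, hU⟩
    obtain ⟨𝓦', h', hc⟩ := exists_refinement h
    -- After shrinking, each choice of `𝓦'` approximates a choice of `𝓦`, so compactness places it
    -- in one member of `𝓓`. There are finitely many choices, so a single member contains them all.
    have key : ∀ A' ∈ choiceImages 𝓦', ∃ U ∈ 𝓓, A' ∈ U.carrier := fun A' hA' => by
      obtain ⟨A, hA, hAA'⟩ := hc A' hA'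
      exact exists_mem_of_upperExt hne hdir (inf_gen_le.1 (inf_sup_le_iff.1 hU A hA)) hAA'
    obtain ⟨U, hU, hle⟩ := Finset.sup_le_of_le_directed 𝓓 hne hdir
      ((choiceImages 𝓦').image fun A => A.inf (Opens.gen E.theory)) (by
        simpa only [Finset.forall_mem_image, inf_gen_le] using key)
    refine ⟨U, hU, 𝓦', h', inf_sup_le_iff.2 fun A hA => ?_⟩
    exact (Finset.le_sup (f := id) (Finset.mem_image_of_mem _ hA)).trans hle⟩

theorem mem_dualFilter {V : Opens E.dual.theory} {U : Opens E.theory} :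
    U ∈ (dualFilter V).1 ↔ ∃ 𝓦 : Finset (Finset G), (∀ B ∈ 𝓦, IsNhd V B) ∧
      𝓦.inf (fun B => B.sup (Opens.gen E.theory)) ≤ U := Iff.rfl

/-- Translates between the two descriptions: the finite joins in `F` are exactly the neighbourhoods
of its dual open. Producing the witness needs the roundedness of `F`. -/
theorem isNhd_dualOpen {F : ScottOpenFilter (Opens E.theory)} {B : Finset G} :
    IsNhd (dualOpen F) B ↔ B.sup (Opens.gen E.theory) ∈ F.1 := by
  refine ⟨fun ⟨C, hC, hCB⟩ => hC B hCB, fun h => ?_⟩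
  obtain ⟨A, hAB, hA⟩ := exists_lowerExt_sup_gen_mem F h
  exact ⟨A, fun D hD => Order.PFilter.mem_of_le (sup_gen_mono hD) hA, hAB⟩

theorem dualFilter_dualOpen (F : ScottOpenFilter (Opens E.theory)) :
    dualFilter (dualOpen F) = F := by
  refine Subtype.ext (Order.PFilter.ext _ _ (Set.ext fun U => ?_))
  change U ∈ (dualFilter (dualOpen F)).1 ↔ U ∈ F.1
  simp only [mem_dualFilter, isNhd_dualOpen]
  refine ⟨?_, Opens.exists_sup_gen_mem F⟩
  rintro ⟨𝓦, h, hU⟩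
  refine Order.PFilter.mem_of_le hU ?_
  clear hU
  induction 𝓦 using Finset.induction_on with
  | empty => exact Order.PFilter.top_mem
  | insert B 𝓦 _ ih =>
    rw [Finset.inf_insert]
    exact Order.PFilter.inf_mem (h B (Finset.mem_insert_self B 𝓦))
      (ih fun B' hB' => h B' (Finset.mem_insert_of_mem hB'))

theorem dualOpen_dualFilter (V : Opens E.dual.theory) : dualOpen (dualFilter V) = V := by
  refine Opens.ext (Set.ext fun C => ⟨fun hC => ?_, fun hC D hD => ?_⟩)
  · refine mem_of_forall_upperExt V fun D hD => ?_
    obtain ⟨𝓦, h, hU⟩ := mem_dualFilter.1 (mem_dualOpen.1 hC D hD)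
    obtain ⟨𝓦', h', hc⟩ := exists_refinement h
    -- Every choice `A'` of the shrunken family satisfies `A' ≪ D`, so it entails some `D' ≺_L D`.
    -- The union of these `D'` is entailed by all choices; read in the dual and distributed, its
    -- meet lies below the join of the meets of the neighbourhoods in `𝓦'`, all of which belong to
    -- `V`.
    have key : ∀ A' ∈ choiceImages 𝓦', ∃ D', E.ent A' D' ∧ LowerExt E.lt D' D := fun A' hA' => by
      obtain ⟨A, hA, hAA'⟩ := hc A' hA'
      exact E.ll_iff.1 (ll_of_inf_gen_le_sup_gen (inf_sup_le_iff.1 hU A hA) hAA')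
    choose! X hX hX' using key
    refine mem_of_upperExt V (C := (choiceImages 𝓦').biUnion X) (LowerExt.biUnion hX') ?_
    rw [← inf_gen_le]
    refine le_trans (le_sup_inf_iff.2 fun A hA => ?_)
      (Finset.sup_le (s := 𝓦') fun B hB => inf_gen_le.2 (h' B hB).mem)
    exact inf_gen_le_sup_gen (E := E.dual)
      (E.isEntailment.weaken (hX A hA) subset_rfl (Finset.subset_biUnion_of_mem X hA))
  · exact mem_dualFilter.2 ⟨{D}, by simpa using ⟨C, hC, hD⟩, by simp⟩

/-- The de Groot dual of the locale of a strong continuous entailment relation is the locale of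
the dual relation. -/
def scottOpenFilterIso (E : StrongContEnt G) :
    ScottOpenFilter (Opens E.theory) ≃o Opens E.dual.theory where
  toFun := dualOpen
  invFun := dualFilter
  left_inv := dualFilter_dualOpen
  right_inv := dualOpen_dualFilter
  map_rel_iff' := by
    intro F F'
    refine ⟨fun h => ?_, fun h C hC D hD => h (hC D hD)⟩
    rw [← dualFilter_dualOpen F, ← dualFilter_dualOpen F']
    rintro U ⟨𝓦, h𝓦, hU⟩
    exact ⟨𝓦, fun B hB => (h𝓦 B hB).imp fun C hC => ⟨h hC.1, hC.2⟩, hU⟩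

end StrongContEnt

/-! ### Interpretations of the geometric theories -/

section Interpretation

variable {G : Type u} {L : Type v} [Order.Frame L]

theorem inf_pair (f : G → L) (x y : G) : (pair x y).inf f = f x ⊓ f y := by
  rw [pair, Finset.inf_insert, Finset.inf_singleton]

theorem sup_pair (f : G → L) (x y : G) : (pair x y).sup f = f x ⊔ f y := by
  rw [pair, Finset.sup_insert, Finset.sup_singleton]

/-- By minimality of the generated relation, soundness of an interpretation need only be checked on
axioms. -/
theorem isEntailment_inf_le_sup (f : G → L) : IsEntailment fun A B => A.inf f ≤ B.sup f where
  refl a := by simp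
  mono A' B' h :=
    (Finset.inf_mono Finset.subset_union_right).trans
      (h.trans (Finset.sup_mono Finset.subset_union_left))
  cut {A B} a h h' := by
    rw [Finset.sup_union, Finset.sup_singleton] at h
    rw [Finset.inf_union, Finset.inf_singleton] at h'
    calc A.inf f ≤ (B.sup f ⊔ f a) ⊓ A.inf f := le_inf h le_rfl
      _ ≤ B.sup f := by
        rw [inf_sup_right]
        exact sup_le inf_le_left h'

theorem isInterpretation_theory_iff {E : StrongContEnt G} {f : G → L} :
    IsInterpretation E.theory f ↔ (∀ A B, E.ent A B → A.inf f ≤ B.sup f) ∧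
      (∀ a b, E.lt a b → f a ≤ f b) ∧ ∀ a, f a ≤ ⨆ b, ⨆ (_ : E.lt b a), f b := by
  constructor
  · intro h
    refine ⟨fun A B hAB => (h (A, _) (SpecAx.ent A B hAB)).trans (iSup₂_le ?_),
      fun a b hab => ?_, fun a => ?_⟩
    · rintro _ ⟨b, hb, rfl⟩
      rw [Finset.inf_singleton]
      exact Finset.le_sup hb
    · simpa using h ({a}, _) (SpecAx.approx a b hab)
    · have := h ({a}, _) (SpecAx.round a)
      rw [Finset.inf_singleton] at this
      refine this.trans (iSup₂_le ?_)
      rintro _ ⟨b, hb, rfl⟩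
      rw [Finset.inf_singleton]
      exact le_iSup₂ (f := fun b (_ : E.lt b a) => f b) b hb
  · rintro ⟨h₁, h₂, h₃⟩ ⟨A, 𝓑⟩ hx
    change SpecAx E A 𝓑 at hx
    change A.inf f ≤ ⨆ B ∈ 𝓑, B.inf f
    cases hx with
    | ent A B hAB =>
      refine (h₁ A B hAB).trans (Finset.sup_le fun b hb => ?_)
      exact le_iSup₂_of_le {b} ⟨b, hb, rfl⟩ (by rw [Finset.inf_singleton])
    | approx a b hab => simpa using h₂ a b hab
    | round a =>
      rw [Finset.inf_singleton]
      refine (h₃ a).trans (iSup₂_le fun b hb => ?_)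
      exact le_iSup₂_of_le {b} ⟨b, hb, rfl⟩ (by rw [Finset.inf_singleton])

/-- One step of the walk: intersect `X ≤ W ⊔ u r` with the bound for the splitting `(r + (t' - t), t
- r)` of `t'`. The cross term `u r ⊓ v (t - r)` belongs to the sum `t` and is absorbed by `W`, so
the argument of `u` moves by `t' - t`. -/
theorem le_sup_add_nsmul {X W : L} {t t' : ℚ} {u v : ℚ → L}
    (h : ∀ r s, r + s = t' → X ≤ u r ⊔ v s) (hW : ∀ r s, r + s = t → u r ⊓ v s ≤ W)
    {c : ℚ} (hc : X ≤ W ⊔ u c) (n : ℕ) : X ≤ W ⊔ u (c + n * (t' - t)) := by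
  induction n with
  | zero => simpa using hc
  | succ n ih =>
    set r := c + n * (t' - t) with hr
    have hr' : c + ((n + 1 : ℕ) : ℚ) * (t' - t) = r + (t' - t) := by push_cast; ring
    rw [hr']
    have h₁ := h (r + (t' - t)) (t - r) (by ring)
    have h₂ := hW r (t - r) (by ring)
    calc X ≤ (W ⊔ u r) ⊓ (u (r + (t' - t)) ⊔ v (t - r)) := le_inf ih h₁
      _ ≤ W ⊔ u (r + (t' - t)) := by
        rw [inf_sup_right, inf_sup_left (u r)]
        exact sup_le (inf_le_left.trans le_sup_left)
          (sup_le (inf_le_right.trans le_sup_right) (h₂.trans le_sup_left))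

/-- The walk starts at `-1`, where `u` is `⊤`, and moves right until it passes `t`. The
complementary argument is then negative, `v` is `⊤` there, and `u` itself is below `W`. -/
theorem le_of_modular_of_top {X W : L} {t t' : ℚ} {u v : ℚ → L} (ht : t < t')
    (h : ∀ r s, r + s = t' → X ≤ u r ⊔ v s) (hW : ∀ r s, r + s = t → u r ⊓ v s ≤ W)
    (hu : ∀ r, r < 0 → u r = ⊤) (hv : ∀ r, r < 0 → v r = ⊤) : X ≤ W := by
  have h₀ : X ≤ W ⊔ u (-1) := by rw [hu _ (by norm_num), sup_top_eq]; exact le_top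
  obtain ⟨n, hn⟩ := exists_nat_gt ((t + 1) / (t' - t))
  rw [div_lt_iff₀ (sub_pos.2 ht)] at hn
  refine (le_sup_add_nsmul h hW h₀ n).trans (sup_le le_rfl ?_)
  have := hW (-1 + n * (t' - t)) (t - (-1 + n * (t' - t))) (by ring)
  rwa [hv _ (by linarith), inf_top_eq] at this

/-- The walk starts at `t' + 1`, whose partner `-1` contributes `⊥`, and moves left until `u` takes
a negative argument and vanishes. -/
theorem le_of_modular_of_bot {X W : L} {t t' : ℚ} {u v : ℚ → L} (ht : t' < t)
    (h : ∀ r s, r + s = t' → X ≤ u r ⊔ v s) (hW : ∀ r s, r + s = t → u r ⊓ v s ≤ W)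
    (hu : ∀ r, r < 0 → u r = ⊥) (hv : ∀ r, r < 0 → v r = ⊥) : X ≤ W := by
  have h₀ : X ≤ W ⊔ u (t' + 1) := by
    have := h (t' + 1) (-1) (by ring)
    rw [hv _ (by norm_num), sup_bot_eq] at this
    exact this.trans le_sup_right
  obtain ⟨n, hn⟩ := exists_nat_gt ((t' + 1) / (t - t'))
  rw [div_lt_iff₀ (sub_pos.2 ht)] at hn
  have := le_sup_add_nsmul h hW h₀ n
  rwa [hu _ (by linarith), sup_bot_eq] at this

/-- The modular inequality with disjunction over all splittings of the sum implies
the corresponding entailments. -/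
theorem le_sup_of_inf_le {X : L} {t : ℚ} {u v : ℚ → L}
    (h : X ≤ ⨆ r, ⨆ s, ⨆ (_ : r + s = t), u r ⊓ v s) {r s : ℚ} (hrs : r + s = t)
    (huv : (Antitone u ∧ Antitone v) ∨ (Monotone u ∧ Monotone v)) : X ≤ u r ⊔ v s := by
  refine h.trans (iSup_le fun r' => iSup_le fun s' => iSup_le fun hrs' => ?_)
  -- Two splittings of the same sum cannot both decrease in each coordinate, so one of the two
  -- factors compares with the required value.
  rcases huv with ⟨hu, hv⟩ | ⟨hu, hv⟩
  · rcases le_total r r' with h | h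
    · exact inf_le_left.trans ((hu h).trans le_sup_left)
    · exact inf_le_right.trans ((hv (by linarith)).trans le_sup_right)
  · rcases le_total r' r with h | h
    · exact inf_le_left.trans ((hu h).trans le_sup_left)
    · exact inf_le_right.trans ((hv (by linarith)).trans le_sup_right)

theorem iSup_splitting_le {S : Type u} (f : ℚ × S → L) (c d : S) (t : ℚ) :
    (⨆ B ∈ {B | ∃ p' q', p' + q' = t ∧ B = pair (p', c) (q', d)}, B.inf f) ≤
      ⨆ r, ⨆ s, ⨆ (_ : r + s = t), f (r, c) ⊓ f (s, d) := by
  refine iSup₂_le ?_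
  rintro _ ⟨r, s, hrs, rfl⟩
  rw [inf_pair]
  exact le_iSup_of_le r (le_iSup_of_le s (le_iSup_of_le hrs le_rfl))

theorem le_iSup_splitting {S : Type u} (f : ℚ × S → L) {c d : S} {t r s : ℚ} (h : r + s = t) :
    f (r, c) ⊓ f (s, d) ≤
      ⨆ B ∈ {B | ∃ p' q', p' + q' = t ∧ B = pair (p', c) (q', d)}, B.inf f :=
  le_iSup₂_of_le (pair (r, c) (s, d)) ⟨r, s, h, rfl⟩ (by rw [inf_pair])

end Interpretation

/-! ### Equivalence of the finitary and infinitary theories of (co)valuations -/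

section Valuations

variable {S : Type u} [StrongProximityLattice S] {L : Type v} [Order.Frame L] {f : ℚ × S → L}

theorem inf_le_sup_of_valAx
    (hf : ∀ A 𝓑, ValThAx S A 𝓑 → A.inf f ≤ ⨆ B ∈ 𝓑, B.inf f) {A B : Finset (ℚ × S)}
    (h : ValAx S A B) : A.inf f ≤ B.sup f := by
  have hanti : ∀ a, Antitone fun p => f (p, a) := fun a p q hpq => by
    simpa using hf _ _ (ValThAx.mono q p a a hpq le_rfl)
  cases h with
  | neg p a hp => simpa using hf _ _ (ValThAx.neg p a hp)
  | bot p hp => simpa using hf _ _ (ValThAx.bot (S := S) p hp)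
  | mono p q a b hpq hab => simpa using hf _ _ (ValThAx.mono p q a b hpq hab)
  | mod₁ p q r s a b hs =>
    rw [sup_pair]
    exact le_sup_of_inf_le ((hf _ _ (ValThAx.mod₁ p q a b)).trans (iSup_splitting_le f _ _ _))
      hs.symm (Or.inl ⟨hanti (a ⊓ b), hanti (a ⊔ b)⟩)
  | mod₂ p q r s a b hs =>
    rw [sup_pair]
    exact le_sup_of_inf_le ((hf _ _ (ValThAx.mod₂ r s a b)).trans (iSup_splitting_le f _ _ _))
      hs (Or.inl ⟨hanti a, hanti b⟩)

theorem inf_le_sup_of_covalAx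
    (hf : ∀ A 𝓑, CovalThAx S A 𝓑 → A.inf f ≤ ⨆ B ∈ 𝓑, B.inf f) {A B : Finset (ℚ × S)}
    (h : CovalAx S A B) : A.inf f ≤ B.sup f := by
  have hmono : ∀ a, Monotone fun p => f (p, a) := fun a p q hpq => by
    simpa using hf _ _ (CovalThAx.mono p q a a hpq le_rfl)
  cases h with
  | neg p a hp => simpa using hf _ _ (CovalThAx.neg p a hp)
  | top p hp => simpa using hf _ _ (CovalThAx.top (S := S) p hp)
  | mono p q a b hpq hab => simpa using hf _ _ (CovalThAx.mono p q a b hpq hab)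
  | mod₁ p q r s a b hs =>
    rw [sup_pair]
    exact le_sup_of_inf_le ((hf _ _ (CovalThAx.mod₁ p q a b)).trans (iSup_splitting_le f _ _ _))
      hs.symm (Or.inr ⟨hmono (a ⊓ b), hmono (a ⊔ b)⟩)
  | mod₂ p q r s a b hs =>
    rw [sup_pair]
    exact le_sup_of_inf_le ((hf _ _ (CovalThAx.mod₂ r s a b)).trans (iSup_splitting_le f _ _ _))
      hs (Or.inr ⟨hmono a, hmono b⟩)

/-- Approximation in the first coordinate alone. -/
theorem inf_le_of_forall_lt {R : ℚ → ℚ → Prop} (hR : ∀ p q, R p q → ∃ r, R p r ∧ R r q)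
    (hlt : ∀ p q a b, R p q → StrongProximityLattice.prec a b → f (p, a) ≤ f (q, b))
    (hround : ∀ p a, f (p, a) ≤ ⨆ y : ℚ × S, ⨆ (_ : R y.1 p ∧ StrongProximityLattice.prec y.2 a), f y)
    {p q : ℚ} {a b : S} {W : L} (h : ∀ p' q', R p' p → R q' q → f (p', a) ⊓ f (q', b) ≤ W) :
    f (p, a) ⊓ f (q, b) ≤ W := by
  refine (inf_le_inf (hround p a) (hround q b)).trans ?_
  simp only [iSup_inf_eq, inf_iSup_eq]
  refine iSup₂_le fun y hy => iSup₂_le fun x hx => ?_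
  -- The rational gap given by rounding is split in two: one part is spent, together with `≺`, on
  -- returning to the original lattice element, the other remains as a strict inequality.
  obtain ⟨p', hp, hp'⟩ := hR _ _ hx.1
  obtain ⟨q', hq, hq'⟩ := hR _ _ hy.1
  exact (inf_le_inf (hlt _ _ _ _ hp hx.2) (hlt _ _ _ _ hq hy.2)).trans (h p' q' hp' hq')

/-- For the modular axioms, rounding replaces `p` and `q` by strictly larger `p'` and `q'`; the gap
between `p + q` and `p' + q'` is what the Archimedean walk needs. -/
theorem inf_le_iSup_of_valThAx (h : ∀ A B, ValAx S A B → A.inf f ≤ B.sup f)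
    (hlt : ∀ x y, valLt S x y → f x ≤ f y)
    (hround : ∀ x, f x ≤ ⨆ y, ⨆ (_ : valLt S y x), f y)
    {A : Finset (ℚ × S)} {𝓑 : Set (Finset (ℚ × S))} (hA : ValThAx S A 𝓑) :
    A.inf f ≤ ⨆ B ∈ 𝓑, B.inf f := by
  have htop : ∀ a p, p < 0 → f (p, a) = ⊤ := fun a p hp => by
    simpa using h _ _ (ValAx.neg p a hp)
  have happrox : ∀ {p q : ℚ} {a b : S} {W : L},
      (∀ p' q', p < p' → q < q' → f (p', a) ⊓ f (q', b) ≤ W) → f (p, a) ⊓ f (q, b) ≤ W :=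
    fun {p q a b W} => inf_le_of_forall_lt (R := fun p q => q < p)
      (fun p q hpq => (exists_between hpq).imp fun _ h => h.symm)
      (fun p q a b hpq hab => hlt (p, a) (q, b) ⟨hpq, hab⟩) fun p a => hround (p, a)
  cases hA with
  | neg p a hp => simpa using h _ _ (ValAx.neg p a hp)
  | bot p hp => simpa using h _ _ (ValAx.bot (S := S) p hp)
  | mono p q a b hpq hab => simpa using h _ _ (ValAx.mono p q a b hpq hab)
  | mod₁ p q a b =>
    rw [inf_pair]
    refine happrox fun p' q' hp hq => ?_
    refine le_of_modular_of_top (u := fun r => f (r, a ⊓ b)) (v := fun r => f (r, a ⊔ b))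
      (add_lt_add hp hq) (fun r s hrs => ?_) (fun r s hrs => le_iSup_splitting f hrs)
      (htop _) (htop _)
    simpa only [inf_pair, sup_pair] using h _ _ (ValAx.mod₁ p' q' r s a b hrs.symm)
  | mod₂ p q a b =>
    rw [inf_pair]
    refine happrox fun p' q' hp hq => ?_
    refine le_of_modular_of_top (u := fun r => f (r, a)) (v := fun r => f (r, b))
      (add_lt_add hp hq) (fun r s hrs => ?_) (fun r s hrs => le_iSup_splitting f hrs)
      (htop _) (htop _)
    simpa only [inf_pair, sup_pair] using h _ _ (ValAx.mod₂ r s p' q' a b hrs)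
  | approx p q a b hqp hab => simpa using hlt (p, a) (q, b) ⟨hqp, hab⟩
  | round p a =>
    rw [Finset.inf_singleton]
    refine (hround (p, a)).trans (iSup₂_le fun y hy => ?_)
    exact le_iSup₂_of_le {y} ⟨y.1, y.2, hy.1, hy.2, rfl⟩ (by rw [Finset.inf_singleton])

/-- Here rounding lowers `p` and `q`, and negative arguments give `⊥`, so the walk runs in the other
direction. -/
theorem inf_le_iSup_of_covalThAx (h : ∀ A B, CovalAx S A B → A.inf f ≤ B.sup f)
    (hlt : ∀ x y, covalLt S x y → f x ≤ f y)
    (hround : ∀ x, f x ≤ ⨆ y, ⨆ (_ : covalLt S y x), f y)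
    {A : Finset (ℚ × S)} {𝓑 : Set (Finset (ℚ × S))} (hA : CovalThAx S A 𝓑) :
    A.inf f ≤ ⨆ B ∈ 𝓑, B.inf f := by
  have hbot : ∀ a p, p < 0 → f (p, a) = ⊥ := fun a p hp => by
    simpa using h _ _ (CovalAx.neg p a hp)
  have happrox : ∀ {p q : ℚ} {a b : S} {W : L},
      (∀ p' q', p' < p → q' < q → f (p', a) ⊓ f (q', b) ≤ W) → f (p, a) ⊓ f (q, b) ≤ W :=
    fun {p q a b W} => inf_le_of_forall_lt (R := fun p q => p < q)
      (fun p q hpq => exists_between hpq)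
      (fun p q a b hpq hab => hlt (p, a) (q, b) ⟨hpq, hab⟩) fun p a => hround (p, a)
  cases hA with
  | neg p a hp => simpa using h _ _ (CovalAx.neg p a hp)
  | top p hp => simpa using h _ _ (CovalAx.top (S := S) p hp)
  | mono p q a b hpq hab => simpa using h _ _ (CovalAx.mono p q a b hpq hab)
  | mod₁ p q a b =>
    rw [inf_pair]
    refine happrox fun p' q' hp hq => ?_
    refine le_of_modular_of_bot (u := fun r => f (r, a ⊓ b)) (v := fun r => f (r, a ⊔ b))
      (add_lt_add hp hq) (fun r s hrs => ?_) (fun r s hrs => le_iSup_splitting f hrs)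
      (hbot _) (hbot _)
    simpa only [inf_pair, sup_pair] using h _ _ (CovalAx.mod₁ p' q' r s a b hrs.symm)
  | mod₂ p q a b =>
    rw [inf_pair]
    refine happrox fun p' q' hp hq => ?_
    refine le_of_modular_of_bot (u := fun r => f (r, a)) (v := fun r => f (r, b))
      (add_lt_add hp hq) (fun r s hrs => ?_) (fun r s hrs => le_iSup_splitting f hrs)
      (hbot _) (hbot _)
    simpa only [inf_pair, sup_pair] using h _ _ (CovalAx.mod₂ r s p' q' a b hrs)
  | approx p q a b hqp hab => simpa using hlt (p, a) (q, b) ⟨hqp, hab⟩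
  | round p a =>
    rw [Finset.inf_singleton]
    refine (hround (p, a)).trans (iSup₂_le fun y hy => ?_)
    exact le_iSup₂_of_le {y} ⟨y.1, y.2, hy.1, hy.2, rfl⟩ (by rw [Finset.inf_singleton])

theorem isInterpretation_val_iff :
    IsInterpretation ({x | ValThAx S x.1 x.2} : GeometricTheory (ℚ × S)) f ↔
      IsInterpretation (valEnt S).theory f := by
  rw [isInterpretation_theory_iff]
  constructor
  · intro hf
    have hf' : ∀ A 𝓑, ValThAx S A 𝓑 → A.inf f ≤ ⨆ B ∈ 𝓑, B.inf f := fun A 𝓑 h => hf (A, 𝓑) h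
    refine ⟨fun A B => Generated.minimal (isEntailment_inf_le_sup f)
      fun _ _ => inf_le_sup_of_valAx hf', fun x y h => ?_, fun x => ?_⟩
    · simpa using hf' _ _ (ValThAx.approx x.1 y.1 x.2 y.2 h.1 h.2)
    · have := hf' _ _ (ValThAx.round x.1 x.2)
      rw [Finset.inf_singleton] at this
      refine this.trans (iSup₂_le ?_)
      rintro _ ⟨q, b, hq, hb, rfl⟩
      rw [Finset.inf_singleton]
      exact le_iSup₂_of_le (f := fun y (_ : (valEnt S).lt y x) => f y) (q, b) ⟨hq, hb⟩ le_rfl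
  · rintro ⟨h₁, h₂, h₃⟩ x hx
    exact inf_le_iSup_of_valThAx (fun A B h => h₁ A B (Generated.ax h)) h₂ h₃ hx

theorem isInterpretation_coval_iff :
    IsInterpretation ({x | CovalThAx S x.1 x.2} : GeometricTheory (ℚ × S)) f ↔
      IsInterpretation (covalEnt S).theory f := by
  rw [isInterpretation_theory_iff]
  constructor
  · intro hf
    have hf' : ∀ A 𝓑, CovalThAx S A 𝓑 → A.inf f ≤ ⨆ B ∈ 𝓑, B.inf f := fun A 𝓑 h => hf (A, 𝓑) h
    refine ⟨fun A B => Generated.minimal (isEntailment_inf_le_sup f)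
      fun _ _ => inf_le_sup_of_covalAx hf', fun x y h => ?_, fun x => ?_⟩
    · simpa using hf' _ _ (CovalThAx.approx x.1 y.1 x.2 y.2 h.1 h.2)
    · have := hf' _ _ (CovalThAx.round x.1 x.2)
      rw [Finset.inf_singleton] at this
      refine this.trans (iSup₂_le ?_)
      rintro _ ⟨q, b, hq, hb, rfl⟩
      rw [Finset.inf_singleton]
      exact le_iSup₂_of_le (f := fun y (_ : (covalEnt S).lt y x) => f y) (q, b) ⟨hq, hb⟩ le_rfl
  · rintro ⟨h₁, h₂, h₃⟩ x hx
    exact inf_le_iSup_of_covalThAx (fun A B h => h₁ A B (Generated.ax h)) h₂ h₃ hx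

theorem isInterpretation_pval_iff :
    IsInterpretation ({x | PValThAx S x.1 x.2} : GeometricTheory (ℚ × S)) f ↔
      IsInterpretation (pvalEnt S).theory f := by
  constructor
  · intro hf
    have hf' : ∀ A 𝓑, PValThAx S A 𝓑 → A.inf f ≤ ⨆ B ∈ 𝓑, B.inf f := fun A 𝓑 h => hf (A, 𝓑) h
    have hv := (isInterpretation_theory_iff.1 (isInterpretation_val_iff.1
      fun x hx => hf' _ _ (PValThAx.val x.1 x.2 hx)))
    refine isInterpretation_theory_iff.2 ⟨fun A B => Generated.minimal (isEntailment_inf_le_sup f)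
      fun A B h => ?_, hv.2⟩
    cases h with
    | val _ _ h => exact hv.1 _ _ (Generated.ax h)
    | le_one p a hp => simpa using hf' _ _ (PValThAx.le_one p a hp)
    | one_le p hp => simpa using hf' _ _ (PValThAx.one_le (S := S) p hp)
  · intro hf
    obtain ⟨h₁, h₂, h₃⟩ := isInterpretation_theory_iff.1 hf
    have h₁' : ∀ A B, PValAx S A B → A.inf f ≤ B.sup f := fun A B h => h₁ A B (Generated.ax h)
    rintro ⟨A, 𝓑⟩ hx
    change PValThAx S A 𝓑 at hx
    change A.inf f ≤ ⨆ B ∈ 𝓑, B.inf f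
    cases hx with
    | val _ _ h =>
      exact inf_le_iSup_of_valThAx (fun A B h => h₁' A B (PValAx.val A B h)) h₂ h₃ h
    | le_one p a hp => simpa using h₁' _ _ (PValAx.le_one p a hp)
    | one_le p hp => simpa using h₁' _ _ (PValAx.one_le (S := S) p hp)

theorem isInterpretation_pcoval_iff :
    IsInterpretation ({x | PCovalThAx S x.1 x.2} : GeometricTheory (ℚ × S)) f ↔
      IsInterpretation (pcovalEnt S).theory f := by
  constructor
  · intro hf
    have hf' : ∀ A 𝓑, PCovalThAx S A 𝓑 → A.inf f ≤ ⨆ B ∈ 𝓑, B.inf f := fun A 𝓑 h => hf (A, 𝓑) h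
    have hv := (isInterpretation_theory_iff.1 (isInterpretation_coval_iff.1
      fun x hx => hf' _ _ (PCovalThAx.coval x.1 x.2 hx)))
    refine isInterpretation_theory_iff.2 ⟨fun A B => Generated.minimal (isEntailment_inf_le_sup f)
      fun A B h => ?_, hv.2⟩
    cases h with
    | coval _ _ h => exact hv.1 _ _ (Generated.ax h)
    | le_one p a hp => simpa using hf' _ _ (PCovalThAx.le_one p a hp)
    | one_le p hp => simpa using hf' _ _ (PCovalThAx.one_le (S := S) p hp)
  · intro hf
    obtain ⟨h₁, h₂, h₃⟩ := isInterpretation_theory_iff.1 hf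
    have h₁' : ∀ A B, PCovalAx S A B → A.inf f ≤ B.sup f := fun A B h => h₁ A B (Generated.ax h)
    rintro ⟨A, 𝓑⟩ hx
    change PCovalThAx S A 𝓑 at hx
    change A.inf f ≤ ⨆ B ∈ 𝓑, B.inf f
    cases hx with
    | coval _ _ h =>
      exact inf_le_iSup_of_covalThAx (fun A B h => h₁' A B (PCovalAx.coval A B h)) h₂ h₃ h
    | le_one p a hp => simpa using h₁' _ _ (PCovalAx.le_one p a hp)
    | one_le p hp => simpa using h₁' _ _ (PCovalAx.one_le (S := S) p hp)

end Valuations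

/-! ### Comparison of presentations -/

/-- The opens of `T` are opens of every theory that holds in the frame presented by `T`. -/
def Opens.transport {G : Type u} {T T' : GeometricTheory G} (h : IsInterpretation T' (gen T))
    (U : Opens T) : Opens T' where
  carrier := U.carrier
  upper := U.upper
  closed := by
    -- Since the generators of `T` interpret `T'`, the family of all `A` with `⋀ A ≤ U` is closed
    -- under the covers of `T'`; that family is `U` itself.
    have := (below h U).closed
    simpa only [below, inf_gen, basic_le, Set.ofPred_mem_eq, Set.mem_ofPred_eq] using this

/-- Two theories over the same generators with the same interpretations present isomorphic
frames. -/
def opensCongr {G : Type u} {T T' : GeometricTheory G}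
    (h : ∀ {L : Type u} [Order.Frame L] {f : G → L}, IsInterpretation T f ↔ IsInterpretation T' f) :
    Opens T ≃o Opens T' where
  toFun := Opens.transport (h.1 (Opens.gen_isInterpretation T))
  invFun := Opens.transport (h.2 (Opens.gen_isInterpretation T'))
  left_inv _ := rfl
  right_inv _ := rfl
  map_rel_iff' := Iff.rfl

/-- The image of a Scott open filter under an isomorphism of frames. -/
def ScottOpenFilter.map {L : Type u} {L' : Type v} [Order.Frame L] [Order.Frame L']
    (e : L ≃o L') (F : ScottOpenFilter L) : ScottOpenFilter L' :=
  ⟨(Order.IsPFilter.of_def (F := {y | e.symm y ∈ F.1}) ⟨⊤, by simp⟩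
    (fun x hx y hy => ⟨x ⊓ y, by simpa using Order.PFilter.inf_mem hx hy, inf_le_left,
      inf_le_right⟩)
    fun hxy hx => Order.PFilter.mem_of_le (e.symm.monotone hxy) hx).toPFilter, by
    intro D hne hdir hD
    change e.symm (sSup D) ∈ F.1 at hD
    rw [OrderIso.map_sSup, ← sSup_image] at hD
    obtain ⟨_, ⟨d, hd, rfl⟩, hdF⟩ := F.2 _ (hne.image _) (by
      rintro _ ⟨x, hx, rfl⟩ _ ⟨y, hy, rfl⟩
      obtain ⟨z, hz, hxz, hyz⟩ := hdir x hx y hy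
      exact ⟨_, ⟨z, hz, rfl⟩, e.symm.monotone hxz, e.symm.monotone hyz⟩) hD
    exact ⟨d, hd, hdF⟩⟩

theorem ScottOpenFilter.mem_map {L : Type u} {L' : Type v} [Order.Frame L] [Order.Frame L']
    {e : L ≃o L'} {F : ScottOpenFilter L} {y : L'} : y ∈ (map e F).1 ↔ e.symm y ∈ F.1 :=
  Iff.rfl

/-- An isomorphism of frames induces an isomorphism of the posets of Scott open filters. -/
def scottOpenFilterCongr {L : Type u} {L' : Type v} [Order.Frame L] [Order.Frame L']
    (e : L ≃o L') : ScottOpenFilter L ≃o ScottOpenFilter L' where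
  toFun := ScottOpenFilter.map e
  invFun := ScottOpenFilter.map e.symm
  left_inv F := Subtype.ext (SetLike.ext fun x => by simp [ScottOpenFilter.mem_map])
  right_inv F := Subtype.ext (SetLike.ext fun x => by simp [ScottOpenFilter.mem_map])
  map_rel_iff' := by
    intro F F'
    refine ⟨fun h x hx => ?_, fun h y hy => h hy⟩
    have : e x ∈ (ScottOpenFilter.map e F).1 := by simpa [ScottOpenFilter.mem_map] using hx
    simpa [ScottOpenFilter.mem_map] using h this

end DeGroot

theorem mainTheorem10 (S : Type u) [StrongProximityLattice S] :
    (Nonempty (StrongContEntIso (valEnt S).dual (covalEnt Sᵒᵈ)) ∧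
      Nonempty (StrongContEntIso (covalEnt S).dual (valEnt Sᵒᵈ))) ∧
    (Nonempty (StrongContEntIso (pvalEnt S).dual (pcovalEnt Sᵒᵈ)) ∧
      Nonempty (StrongContEntIso (pcovalEnt S).dual (pvalEnt Sᵒᵈ))) ∧
    (Nonempty (ScottOpenFilter (ValSpace S) ≃o CovalSpace Sᵒᵈ) ∧
      Nonempty (ScottOpenFilter (CovalSpace S) ≃o ValSpace Sᵒᵈ)) ∧
    (Nonempty (ScottOpenFilter (PValSpace S) ≃o PCovalSpace Sᵒᵈ) ∧
      Nonempty (ScottOpenFilter (PCovalSpace S) ≃o PValSpace Sᵒᵈ)) := by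
  -- The four localic statements share one argument: replace each theory by that of its entailment
  -- relation and apply the general duality in between.
  have key : ∀ {G : Type u} {T T' : GeometricTheory G} {E E' : StrongContEnt G},
      (∀ {L : Type u} [Order.Frame L] {f : G → L},
        IsInterpretation T f ↔ IsInterpretation E.theory f) →
      (∀ {L : Type u} [Order.Frame L] {f : G → L},
        IsInterpretation T' f ↔ IsInterpretation E'.theory f) →
      E.dual = E' → Nonempty (ScottOpenFilter (Opens T) ≃o Opens T') := by
    rintro G T T' E _ h h' rfl
    exact ⟨(scottOpenFilterCongr (opensCongr h)).trans
      (E.scottOpenFilterIso.trans (opensCongr h').symm)⟩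
  refine ⟨⟨?_, ?_⟩, ⟨?_, ?_⟩, ⟨?_, ?_⟩, ⟨?_, ?_⟩⟩
  · exact dual_valEnt S ▸ ⟨StrongContEnt.isoRefl _⟩
  · exact dual_covalEnt S ▸ ⟨StrongContEnt.isoRefl _⟩
  · exact dual_pvalEnt S ▸ ⟨StrongContEnt.isoRefl _⟩
  · exact dual_pcovalEnt S ▸ ⟨StrongContEnt.isoRefl _⟩
  · exact key isInterpretation_val_iff (isInterpretation_coval_iff (S := Sᵒᵈ)) (dual_valEnt S)
  · exact key isInterpretation_coval_iff (isInterpretation_val_iff (S := Sᵒᵈ)) (dual_covalEnt S)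
  · exact key isInterpretation_pval_iff (isInterpretation_pcoval_iff (S := Sᵒᵈ)) (dual_pvalEnt S)
  · exact key isInterpretation_pcoval_iff (isInterpretation_pval_iff (S := Sᵒᵈ))
      (dual_pcovalEnt S)
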